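/- Let $p$ be an odd prime. Let $\Gamma(p)\subset \mathrm{SL}_3(\mathbb Z)$ and $\Gamma_2(p)\subset \mathrm{SL}_2(\mathbb Z)$ be the level $p$ congruence subgroups, i.e. the kernels of reduction modulo $p$, and let $P_1\subset \mathrm{SL}_3(\mathbb Z)$ be the subgroup of matrices whose first column has zeros as its second and third entries. Then $$P_1\cap\Gamma(p)=\left\{\begin{pmatrix}1&v\\0&A\end{pmatrix} : v\in (p\mathbb Z)^2 \text{ (a row vector)},\ A\in\Gamma_2(p)\right\},$$ and, if $\Gamma_2(p)$ acts on row vectors in $\mathbb Z^2$ by letting $A$ send $v$ to $vA^{-1}$, there is an isomorphism $\mathbb Z^2\rtimes\Gamma_2(p)\cong P_1\cap\Gamma(p)$ that sends $v\in\mathbb Z^2$ to $\begin{pmatrix}1&pv\\0&I\end{pmatrix}$ and $A\in\Gamma_2(p)$ to $\begin{pmatrix}1&0\\0&A\end{pmatrix}$. Moreover, let $M=\mathbb Z^2$ be the natural $\Gamma_2(p)$-module (matrices acting on column vectors), and let $\mathbb Z$ carry the trivial action of each group. Then, as abelian groups, $$H^i(P_1\cap\Gamma(p),\mathbb Z)\cong\begin{cases}\mathbb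 Z & i=0\\ H^1(\Gamma_2(p),\mathbb Z) & i=1\\ H^1(\Gamma_2(p),M)\oplus\mathbb Z & i=2\\ H^1(\Gamma_2(p),\mathbb Z) & i=3\\ 0 & i\ge 4.\end{cases}$$ -/

import Mathlib

open CongruenceSubgroup
open scoped MatrixGroups

namespace SL3Parabolic

/-- The level `p` congruence subgroup of `SL₃(ℤ)`: the kernel of reduction modulo `p`. -/
def Gamma3 (p : ℕ) : Subgroup SL(3, ℤ) :=
  (Matrix.SpecialLinearGroup.map (n := Fin 3) (Int.castRingHom (ZMod p))).ker

/-- The parabolic subgroup of `SL₃(ℤ)` of the matrices whose first column has zeros as its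
second and third entries. -/
def P1 : Subgroup SL(3, ℤ) where
  carrier := {g | g 1 0 = 0 ∧ g 2 0 = 0}
  mul_mem' := by
    rintro a b ⟨ha1, ha2⟩ ⟨hb1, hb2⟩
    constructor <;>
      simp [Matrix.SpecialLinearGroup.coe_mul, Matrix.mul_apply, Fin.sum_univ_three, *]
  one_mem' := by simp
  inv_mem' := by
    rintro a ⟨h1, h2⟩
    constructor <;>
      simp [Matrix.SpecialLinearGroup.coe_inv, Matrix.adjugate_fin_three, h1, h2]

/-- The group `P₁ ∩ Γ(p)`. -/
abbrev P1Gamma (p : ℕ) : Subgroup SL(3, ℤ) := P1 ⊓ Gamma3 p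

/-- The action of `Γ₂(p) ⊆ SL₂(ℤ)` on row vectors in `ℤ²`, a matrix `A` acting by
`v ↦ v * A⁻¹`. -/
def rowAction (p : ℕ) : Gamma p →* MulAut (Multiplicative (Fin 2 → ℤ)) where
  toFun A :=
    { toFun := fun v => Multiplicative.ofAdd
        (Matrix.vecMul v.toAdd ((A : SL(2, ℤ))⁻¹ : SL(2, ℤ)).1)
      invFun := fun v => Multiplicative.ofAdd (Matrix.vecMul v.toAdd (A : SL(2, ℤ)).1)
      left_inv := fun v => by
        simp only [toAdd_ofAdd, Matrix.vecMul_vecMul, ← Matrix.SpecialLinearGroup.coe_mul]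
        simp
      right_inv := fun v => by
        simp only [toAdd_ofAdd, Matrix.vecMul_vecMul, ← Matrix.SpecialLinearGroup.coe_mul]
        simp
      map_mul' := fun v w => by
        simp only [toAdd_mul, Matrix.add_vecMul, ofAdd_add] }
  map_one' := by
    ext v : 1
    simp
  map_mul' A B := by
    ext v : 1
    simp only [MulEquiv.coe_mk, Equiv.coe_fn_mk, MulAut.mul_apply, toAdd_ofAdd,
      Matrix.vecMul_vecMul, ← Matrix.SpecialLinearGroup.coe_mul, Subgroup.coe_mul, mul_inv_rev]

/-- The natural `Γ₂(p)`-module `M = ℤ ⊕ ℤ`, matrices acting on column vectors. -/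
noncomputable def naturalModule (p : ℕ) : Rep ℤ (Gamma p) :=
  Rep.of (X := Fin 2 → ℤ)
    { toFun := fun A => Matrix.mulVecLin (A : SL(2, ℤ)).1
      map_one' := by simp [Module.End.one_eq_id]
      map_mul' := fun A B => by
        simp [Matrix.mulVecLin_mul, Module.End.mul_eq_comp] }

/-- Group cohomology `Hⁿ(G, ℤ)` with trivial integral coefficients. -/
noncomputable abbrev integralCohomology (G : Type) [Group G] (n : ℕ) : ModuleCat ℤ :=
  groupCohomology (Rep.trivial ℤ G ℤ) n

end SL3Parabolic

/-!
The description of `P₁ ∩ Γ(p)` and its semidirect product structure are block matrix computations: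
the upper left entry is a unit of `ℤ` congruent to `1` modulo `p ≥ 3`, hence equal to `1`. The
cohomology is that of an extension `1 → ℤ² → G → Γ₂(p) → 1` whose quotient is a free group.

*Freeness of `Γ₂(p)`.* The group `PSL₂(ℤ)` is the free product of cyclic groups of orders two and
three, by the ping-pong lemma (`freeProductHom_injective`). For `p ≥ 3`, `Γ₂(p)` embeds in it and
has no elements of order two or three, so it misses all conjugates of the factors. A subgroup `F` of
a free product `P` which does so is projective (`exists_section_of_surjective`): given a surjection
`E → F`, the right translation action of each factor on `P` lifts to `P × E`, because the factor acts
freely on the cosets of `F`; the lifts assemble to an action of `P`, and following `(1, 1)` under `F`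
gives a splitting. So such a subgroup embeds in a free group, and is free by the Nielsen-Schreier
theorem (`isFreeGroup_of_forall_conj`).

*The exact sequence.* Let `q : G → F` be onto a free group with basis `b`, let `N = ker q`, and
let `V` be a trivial module. As the Cayley graph of a free group is a tree,
`0 → V → Coind_N V → Coind_N (ι → V) → 0` is exact (`wangComplex_shortExact`), the second map being
`φ ↦ (φ - φ(sᵢ⁻¹ ·))ᵢ` for lifts `sᵢ` of the `bᵢ`. With Shapiro's lemma it becomes the sequence
`… → Hⁿ(G, V) → Hⁿ(N, V) → Hⁿ(N, V)^ι → Hⁿ⁺¹(G, V) → …`. Applied to `ℤ → ℤ` and `ℤ² → ℤ` it yields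
`H²(ℤ², V) = V` and `Hⁿ(ℤ², V) = 0` for `n ≥ 3`.

*Degrees two and three.* The determinant is an `SL₂(ℤ)`-invariant alternating form on `ℤ²`, so it
extends to a 2-cocycle on `G` (`detCocycle`). Not being symmetric on `ℤ²`, it is nonzero in
`H²(ℤ², ℤ) = ℤ`. Hence the image of `H²(G, ℤ)` there is infinite cyclic and splits off, and the
complement is the cokernel of `H¹(ℤ², ℤ) → H¹(ℤ², ℤ)^ι`, `m ↦ (m - bᵢ m)ᵢ`, which is `H¹(Γ₂(p), M)`
because crossed homomorphisms on a free group are determined by arbitrary values on a basis. Also,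
`H²(ℤ², ℤ) → H²(ℤ², ℤ)^ι` kills a nonzero element of `ℤ`, so it vanishes, and `H³(G, ℤ)` is
`ℤ^ι = Hom(Γ₂(p), ℤ)`. Degree one is the group of homomorphisms to `ℤ`, which vanish on `ℤ²` because
`Γ₂(p)` has no nonzero invariants in `M`.
-/

namespace SL3Parabolic

/-! ### Subgroups of free products -/

section FreeProduct

open Monoid

variable {ι : Type*} {H : ι → Type*} [∀ i, Group (H i)]

/-- If no conjugate of the subgroup `K` meets `F` nontrivially, the double cosets `F t K` are free,
so the left `F`-coordinate can be chosen to be `F`-equivariant and right `K`-invariant. -/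
theorem exists_equivariant_coordinate {P : Type*} [Group P] (F K : Subgroup P)
    (h : ∀ t : P, ∀ k ∈ K, t * k * t⁻¹ ∈ F → k = 1) :
    ∃ s : P → F, (∀ (f : F) x, s (f * x) = f * s x) ∧ ∀ x, ∀ k ∈ K, s (x * k) = s x := by
  have key : ∀ x : P, ∃ f : F, ∃ k ∈ K,
      x = f * (DoubleCoset.mk F K x : DoubleCoset.Quotient (F : Set P) K).out * k := by
    intro x
    obtain ⟨a, b, ha, hb, hab⟩ := DoubleCoset.mk_out_eq_mul F K x
    refine ⟨⟨a, ha⟩⁻¹, b⁻¹, K.inv_mem hb, ?_⟩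
    rw [hab]; simp; group
  choose s k hk hx using key
  have uniq : ∀ (t : P) (f f' : F) (l l' : P), l ∈ K → l' ∈ K → f * t * l = f' * t * l' →
      f = f' := by
    intro t f f' l l' hl hl' e
    have e1 : t * (l' * l⁻¹) * t⁻¹ = ((f'⁻¹ * f : F) : P) := by
      push_cast
      have : f * t = f' * t * l' * l⁻¹ := by rw [← e]; group
      have : (f : P) = f' * t * l' * l⁻¹ * t⁻¹ := by rw [← this]; group
      rw [this]; group
    have e2 := h t (l' * l⁻¹) (K.mul_mem hl' (K.inv_mem hl)) (e1 ▸ (f'⁻¹ * f).2)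
    rw [e2] at e1
    have : f'⁻¹ * f = 1 := Subtype.ext (by simpa using e1.symm)
    exact (inv_mul_eq_one.1 this).symm
  refine ⟨s, fun f x => ?_, fun x l hl => ?_⟩
  · have hmk : DoubleCoset.mk F K (f * x) = DoubleCoset.mk F K x :=
      (DoubleCoset.eq F K _ _).2 ⟨f⁻¹, F.inv_mem f.2, 1, K.one_mem, by simp⟩
    have h1 := hx (f * x)
    rw [hmk] at h1
    refine uniq _ _ (f * s x) _ _ (hk _) (hk x) (h1.symm.trans ?_)
    conv_lhs => rw [hx x]
    push_cast; group
  · have hmk : DoubleCoset.mk F K (x * l) = DoubleCoset.mk F K x :=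
      (DoubleCoset.eq F K _ _).2 ⟨1, F.one_mem, l⁻¹, K.inv_mem hl, by simp⟩
    have h1 := hx (x * l)
    rw [hmk] at h1
    refine uniq _ _ (s x) _ _ (hk _) (K.mul_mem (hk x) hl) (h1.symm.trans ?_)
    conv_lhs => rw [hx x]
    group

/-- A subgroup `F` of a free product which meets every conjugate of every factor trivially is
projective: every surjection onto `F` splits. -/
theorem exists_section_of_surjective (F : Subgroup (CoprodI H))
    (hF : ∀ (t : CoprodI H) (i : ι) (h : H i), t * CoprodI.of h * t⁻¹ ∈ F → h = 1)
    {E : Type*} [Group E] (π : E →* F) (hπ : Function.Surjective π) :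
    ∃ σ : F →* E, π.comp σ = MonoidHom.id F := by
  have hcoord (i : ι) := exists_equivariant_coordinate F (CoprodI.of (M := H) (i := i)).range (by
    rintro t _ ⟨h, rfl⟩ hm
    rw [hF t i h hm, map_one])
  choose c hcl hcr using hcoord
  obtain ⟨r, hr, -⟩ := exists_equivariant_coordinate F ⊥ (by
    rintro t k hk -
    simpa using hk)
  -- normalise the reference coordinate so that it is `1` at `1`
  let s : CoprodI H → F := fun x => r x * (r 1)⁻¹
  have hs : ∀ (f : F) x, s (f * x) = f * s x := fun f x => by simp [s, hr, mul_assoc]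
  have hs1 : s 1 = 1 := by simp [s]
  -- the correction terms are left `F`-invariant, hence so are their lifts to `E`
  have hv : ∀ i (f : F) x, (c i (f * x))⁻¹ * s (f * x) = (c i x)⁻¹ * s x := fun i f x => by
    rw [hcl, hs]; group
  let u : ι → CoprodI H → E := fun i x => Function.surjInv hπ ((c i x)⁻¹ * s x)
  have hu : ∀ i x, π (u i x) = (c i x)⁻¹ * s x := fun i x => Function.surjInv_eq hπ _
  have huF : ∀ i (f : F) x, u i (f * x) = u i x := fun i f x => by simp only [u, hv]
  -- the lift of right translation by the factor `H i`: with `s` and `c i` as `F`-coordinates, its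
  -- image in `F` is `(s x)⁻¹ * s (x * g⁻¹)`, which is the coboundary of the correction term
  let ρ₀ : ∀ i, H i →* Equiv.Perm (CoprodI H × E) := fun i =>
    { toFun := fun g =>
        { toFun := fun z => (z.1 * (CoprodI.of g)⁻¹,
            z.2 * (u i z.1)⁻¹ * u i (z.1 * (CoprodI.of g)⁻¹))
          invFun := fun z => (z.1 * CoprodI.of g, z.2 * (u i z.1)⁻¹ * u i (z.1 * CoprodI.of g))
          left_inv := fun z => by ext <;> simp
          right_inv := fun z => by ext <;> simp }
      map_one' := by ext z <;> simp
      map_mul' := fun g h => by ext z <;> simp [mul_assoc] }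
  let ρ : CoprodI H →* Equiv.Perm (CoprodI H × E) := CoprodI.lift ρ₀
  have hρ₀ : ∀ i (g : H i) z, ρ (CoprodI.of g) z = (z.1 * (CoprodI.of g)⁻¹,
            z.2 * (u i z.1)⁻¹ * u i (z.1 * (CoprodI.of g)⁻¹)) := fun i g z => by
    simp only [ρ, CoprodI.lift_of]; rfl
  have hfst : ∀ g z, (ρ g z).1 = z.1 * g⁻¹ := by
    intro g
    induction g using CoprodI.induction_on with
    | one => simp
    | of i m => intro z; rw [hρ₀]
    | mul x y hx hy => intro z; rw [map_mul, Equiv.Perm.mul_apply, hx, hy]; group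
  -- the action commutes with left translation by `F` and by `E`
  have hcomm : ∀ g (f : F) (e : E) x y,
      ρ g (f * x, e * y) = (f * (ρ g (x, y)).1, e * (ρ g (x, y)).2) := by
    intro g
    induction g using CoprodI.induction_on with
    | one => simp
    | of i m => intro f e x y; simp only [hρ₀, mul_assoc, huF]
    | mul a b ha hb =>
      intro f e x y
      rw [map_mul, Equiv.Perm.mul_apply, hb, ha]; rfl
  -- an invariant of the action which compares the `E`-coordinate with the `F`-coordinate
  have hinv : ∀ g z, π (ρ g z).2 * (s (ρ g z).1)⁻¹ = π z.2 * (s z.1)⁻¹ := by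
    intro g
    induction g using CoprodI.induction_on with
    | one => simp
    | of i m =>
      intro z
      rw [hρ₀]
      simp only [map_mul, map_inv, hu]
      rw [hcr i z.1 _ (inv_mem ⟨m, rfl⟩)]; group
    | mul a b ha hb => intro z; rw [map_mul, Equiv.Perm.mul_apply, ha, hb]
  have hval : ∀ f : F, ρ (f : CoprodI H)⁻¹ (1, 1) =
      ((f : CoprodI H), (ρ (f : CoprodI H)⁻¹ (1, 1)).2) :=
    fun f => Prod.ext (by rw [hfst]; simp) rfl
  refine ⟨MonoidHom.mk' (fun f => (ρ (f : CoprodI H)⁻¹ (1, 1)).2) fun f g => ?_, ?_⟩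
  · have := hcomm (g : CoprodI H)⁻¹ f (ρ (f : CoprodI H)⁻¹ (1, 1)).2 1 1
    rw [mul_one, mul_one, ← hval] at this
    rw [Subgroup.coe_mul, mul_inv_rev, map_mul, Equiv.Perm.mul_apply, this]
  · ext f : 1
    have := hinv (f : CoprodI H)⁻¹ (1, 1)
    have h2 : s (f : CoprodI H) = f := by simpa [hs1] using hs f 1
    rw [hfst, one_mul, inv_inv, h2] at this
    simpa [hs1, mul_inv_eq_one] using this

/-- The part of the Kurosh subgroup theorem about subgroups that miss the conjugates of the factors. -/
theorem isFreeGroup_of_forall_conj (F : Subgroup (CoprodI H))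
    (hF : ∀ (t : CoprodI H) (i : ι) (h : H i), t * CoprodI.of h * t⁻¹ ∈ F → h = 1) :
    IsFreeGroup F := by
  obtain ⟨σ, hσ⟩ := exists_section_of_surjective F hF (FreeGroup.lift (id : F → F))
    fun f => ⟨FreeGroup.of f, by simp⟩
  have hinj : Function.Injective σ := fun a b hab => by
    simpa [hab] using (DFunLike.congr_fun hσ a).symm.trans
      ((congrArg _ hab).trans (DFunLike.congr_fun hσ b))
  exact IsFreeGroup.ofMulEquiv (MonoidHom.ofInjective hinj).symm

end FreeProduct

/-! ### The principal congruence subgroup is free -/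

section PrincipalCongruence

open Monoid

theorem entries_of_mem_Gamma {p : ℕ} {g : SL(2, ℤ)} (hg : g ∈ Gamma p) :
    ∃ a b c d : ℤ, g.1 0 0 = 1 + p * a ∧ g.1 0 1 = p * b ∧ g.1 1 0 = p * c ∧
      g.1 1 1 = 1 + p * d := by
  obtain ⟨h1, h2, h3, h4⟩ := Gamma_mem.1 hg
  have e : ∀ x y : ℤ, ((x : ℤ) : ZMod p) = y → ∃ a : ℤ, x = y + p * a := fun x y h => by
    obtain ⟨a, ha⟩ := (ZMod.intCast_eq_intCast_iff_dvd_sub y x p).1 h.symm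
    exact ⟨a, by linarith⟩
  obtain ⟨a, ha⟩ := e _ 1 (by simpa using h1)
  obtain ⟨b, hb⟩ := e _ 0 (by simpa using h2)
  obtain ⟨c, hc⟩ := e _ 0 (by simpa using h3)
  obtain ⟨d, hd⟩ := e _ 1 (by simpa using h4)
  exact ⟨a, b, c, d, ha, by simpa using hb, by simpa using hc, hd⟩

theorem eq_one_of_entries {g : SL(2, ℤ)} (h1 : g.1 0 0 = 1) (h2 : g.1 0 1 = 0)
    (h3 : g.1 1 0 = 0) (h4 : g.1 1 1 = 1) : g = 1 := by
  ext i j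
  fin_cases i <;> fin_cases j <;> simpa

theorem det_entries (g : SL(2, ℤ)) : g.1 0 0 * g.1 1 1 - g.1 0 1 * g.1 1 0 = 1 := by
  rw [← Matrix.det_fin_two, g.2]

theorem one_add_mul_ne_neg_one {p : ℕ} (hp : 3 ≤ p) (a : ℤ) : 1 + (p : ℤ) * a ≠ -1 := by
  intro h
  have h2 : (p : ℤ) ∣ 2 := ⟨-a, by linarith⟩
  have := Int.le_of_dvd (by norm_num) h2
  omega

theorem eq_one_of_diagonal {p : ℕ} (hp : 3 ≤ p) {g : SL(2, ℤ)} (hg : g ∈ Gamma p)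
    (h2 : g.1 0 1 = 0) (h3 : g.1 1 0 = 0) : g = 1 := by
  obtain ⟨a, b, c, d, ha, hb, hc, hd⟩ := entries_of_mem_Gamma hg
  have hdet := det_entries g
  rw [h2, zero_mul, sub_zero] at hdet
  rcases Int.mul_eq_one_iff_eq_one_or_neg_one.1 hdet with ⟨h, h'⟩ | ⟨h, h'⟩
  · exact eq_one_of_entries h h2 h3 h'
  · exact (one_add_mul_ne_neg_one hp a (ha ▸ h)).elim

theorem inv_entries (g : SL(2, ℤ)) :
    (g⁻¹).1 0 0 = g.1 1 1 ∧ (g⁻¹).1 0 1 = -g.1 0 1 ∧ (g⁻¹).1 1 0 = -g.1 1 0 ∧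
      (g⁻¹).1 1 1 = g.1 0 0 := by
  simp [Matrix.SpecialLinearGroup.coe_inv, Matrix.adjugate_fin_two]

theorem eq_one_of_sq_eq_one {p : ℕ} (hp : 3 ≤ p) {g : SL(2, ℤ)} (hg : g ∈ Gamma p)
    (h : g ^ 2 = 1) : g = 1 := by
  have h' : g⁻¹ = g := inv_eq_of_mul_eq_one_left (by rw [← sq, h])
  obtain ⟨-, h2, h3, -⟩ := inv_entries g
  rw [h'] at h2 h3
  exact eq_one_of_diagonal hp hg (by omega) (by omega)

/-- An element of order three has trace `-1`, whereas determinant one forces the trace of an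
element of `Γ(p)` to be `2` modulo `p²`. -/
theorem eq_one_of_pow_three_eq_one {p : ℕ} (hp : 3 ≤ p) {g : SL(2, ℤ)} (hg : g ∈ Gamma p)
    (h : g ^ 3 = 1) : g = 1 := by
  have h' : g⁻¹ = g * g := inv_eq_of_mul_eq_one_left (by rw [← h, pow_succ, sq])
  obtain ⟨-, h2, h3, -⟩ := inv_entries g
  obtain ⟨a, b, c, d, ha, hb, hc, hd⟩ := entries_of_mem_Gamma hg
  have hdet := det_entries g
  rw [h', Matrix.SpecialLinearGroup.coe_mul, Matrix.mul_apply, Fin.sum_univ_two] at h2 h3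
  by_cases ht : g.1 0 0 + g.1 1 1 = -1
  · exfalso
    rw [ha, hd] at ht
    rw [ha, hb, hc, hd] at hdet
    have h9 : ((p : ℤ) * p) * (b * c - a * d) = -3 := by linear_combination -hdet - (-1) * ht
    have hdvd : ((p : ℤ) * p) ∣ 3 := ⟨-(b * c - a * d), by linarith⟩
    have := Int.le_of_dvd (by norm_num) hdvd
    have : (3 : ℤ) ≤ p := by exact_mod_cast hp
    nlinarith
  · have ht' : g.1 0 0 + g.1 1 1 + 1 ≠ 0 := fun e => ht (by linarith)
    refine eq_one_of_diagonal hp hg ?_ ?_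
    · exact (mul_eq_zero.1 (by linear_combination h2 :
        g.1 0 1 * (g.1 0 0 + g.1 1 1 + 1) = 0)).resolve_right ht'
    · exact (mul_eq_zero.1 (by linear_combination h3 :
        g.1 1 0 * (g.1 0 0 + g.1 1 1 + 1) = 0)).resolve_right ht'

/-- The action `X ↦ g X gᵀ` of `SL₂(ℤ)` on integral matrices; its kernel is `{±1}`, so that its
range is a model of `PSL₂(ℤ)`. -/
def congruenceAction : SL(2, ℤ) →* Equiv.Perm (Matrix (Fin 2) (Fin 2) ℤ) where
  toFun g :=
    { toFun := fun X => g.1 * X * g.1.transpose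
      invFun := fun X => (g⁻¹).1 * X * (g⁻¹).1.transpose
      left_inv := fun X => by
        have h : (g⁻¹).1 * g.1 = 1 := by rw [← Matrix.SpecialLinearGroup.coe_mul]; simp
        have h' : g.1.transpose * (g⁻¹).1.transpose = 1 := by
          rw [← Matrix.transpose_mul, h, Matrix.transpose_one]
        calc _ = ((g⁻¹).1 * g.1) * X * (g.1.transpose * (g⁻¹).1.transpose) := by
              simp only [Matrix.mul_assoc]
          _ = X := by rw [h, h']; simp
      right_inv := fun X => by
        have h : g.1 * (g⁻¹).1 = 1 := by rw [← Matrix.SpecialLinearGroup.coe_mul]; simp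
        have h' : (g⁻¹).1.transpose * g.1.transpose = 1 := by
          rw [← Matrix.transpose_mul, h, Matrix.transpose_one]
        calc _ = (g.1 * (g⁻¹).1) * X * ((g⁻¹).1.transpose * g.1.transpose) := by
              simp only [Matrix.mul_assoc]
          _ = X := by rw [h, h']; simp }
  map_one' := by ext1 X; simp
  map_mul' g h := by ext1 X; simp [Matrix.mul_assoc, Matrix.transpose_mul]

theorem congruenceAction_apply (g : SL(2, ℤ)) (X) :
    congruenceAction g X = g.1 * X * g.1.transpose := rfl

theorem congruenceAction_vecMulVec (g : SL(2, ℤ)) (v : Fin 2 → ℤ) :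
    congruenceAction g (Matrix.vecMulVec v v) =
      Matrix.vecMulVec (g.1.mulVec v) (g.1.mulVec v) := by
  rw [congruenceAction_apply]
  ext i j
  fin_cases i <;> fin_cases j <;>
    simp [Matrix.mul_apply, Matrix.vecMulVec_apply, Fin.sum_univ_two] <;> ring

theorem eq_one_of_congruenceAction_eq_one {p : ℕ} (hp : 3 ≤ p) {g : SL(2, ℤ)} (hg : g ∈ Gamma p)
    (h : congruenceAction g = 1) : g = 1 := by
  have h1 := congr_fun (congr_fun ((congruenceAction_apply g !![1, 0; 0, 0]).symm.trans
    (by rw [h])) 1) 1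
  have h2 := congr_fun (congr_fun ((congruenceAction_apply g !![0, 0; 0, 1]).symm.trans
    (by rw [h])) 0) 0
  simp [Matrix.mul_apply, Fin.sum_univ_two] at h1 h2
  exact eq_one_of_diagonal hp hg h2 h1

/-- Lifts to `SL₂(ℤ)` of generators of `PSL₂(ℤ)` of orders two (`false`) and three (`true`). -/
def torsionGenerator : Bool → SL(2, ℤ)
  | false => ModularGroup.S
  | true => ModularGroup.S * ModularGroup.T

theorem coe_torsionGenerator_true : (torsionGenerator true).1 = !![0, -1; 1, 1] := by
  decide

theorem coe_torsionGenerator_true_sq : (torsionGenerator true ^ 2).1 = !![-1, -1; 1, 0] := by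
  decide

theorem congruenceAction_neg_one : congruenceAction (-1) = 1 := by
  ext1 X
  simp [congruenceAction_apply]

theorem torsionGenerator_false_sq : torsionGenerator false ^ 2 = -1 := by
  decide +revert

theorem torsionGenerator_true_cube : torsionGenerator true ^ 3 = -1 := by
  decide +revert

/-- The cyclic factors of the free product decomposition of `PSL₂(ℤ)`. -/
abbrev factor (i : Bool) : Subgroup (Equiv.Perm (Matrix (Fin 2) (Fin 2) ℤ)) :=
  Subgroup.zpowers (congruenceAction (torsionGenerator i))

/-- The canonical map of the free product of the two factors to permutations; its image is the model
of `PSL₂(ℤ)`. -/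
abbrev freeProductHom : CoprodI (fun i => factor i) →* Equiv.Perm (Matrix (Fin 2) (Fin 2) ℤ) :=
  CoprodI.lift fun i => (factor i).subtype

theorem exists_pow_of_mem_zpowers {P : Type*} [Group P] {x y : P} {n : ℕ} (hn : n ≠ 0)
    (hx : x ^ n = 1) (hy : y ∈ Subgroup.zpowers x) : ∃ m < n, y = x ^ m := by
  obtain ⟨k, rfl⟩ := Subgroup.mem_zpowers_iff.1 hy
  have hn' : (0 : ℤ) < n := by positivity
  refine ⟨(k % n).toNat, by have := Int.emod_lt_of_pos k hn'; omega, ?_⟩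
  have h0 := Int.emod_nonneg k hn'.ne'
  rw [← zpow_natCast, Int.toNat_of_nonneg h0]
  conv_lhs => rw [← Int.emod_add_mul_ediv k n, zpow_add, zpow_mul, zpow_natCast, hx, one_zpow,
    mul_one]

theorem congruenceAction_torsionGenerator_false_sq :
    congruenceAction (torsionGenerator false) ^ 2 = 1 := by
  rw [← map_pow, torsionGenerator_false_sq, congruenceAction_neg_one]

theorem congruenceAction_torsionGenerator_true_cube :
    congruenceAction (torsionGenerator true) ^ 3 = 1 := by
  rw [← map_pow, torsionGenerator_true_cube, congruenceAction_neg_one]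

/-- The ping-pong sets: squares `v vᵀ` of vectors in the open first and third quadrants (`false`), or
in the open second and fourth quadrants (`true`). -/
def quadrant (i : Bool) : Set (Matrix (Fin 2) (Fin 2) ℤ) :=
  {X | ∃ v : Fin 2 → ℤ, X = Matrix.vecMulVec v v ∧
    match i with
    | false => 0 < v 0 * v 1
    | true => v 0 * v 1 < 0}

theorem freeProductHom_injective : Function.Injective freeProductHom := by
  have hact : ∀ (g : SL(2, ℤ)) (v : Fin 2 → ℤ),
      congruenceAction g • Matrix.vecMulVec v v =
        Matrix.vecMulVec ![g.1 0 0 * v 0 + g.1 0 1 * v 1, g.1 1 0 * v 0 + g.1 1 1 * v 1]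
          ![g.1 0 0 * v 0 + g.1 0 1 * v 1, g.1 1 0 * v 0 + g.1 1 1 * v 1] := by
    intro g v
    have : g.1.mulVec v = ![g.1 0 0 * v 0 + g.1 0 1 * v 1, g.1 1 0 * v 0 + g.1 1 1 * v 1] := by
      ext i; fin_cases i <;> simp [Matrix.mulVec, dotProduct, Fin.sum_univ_two]
    rw [← this]
    exact congruenceAction_vecMulVec g v
  refine CoprodI.lift_injective_of_ping_pong _ (Or.inr ⟨true, ?_⟩) quadrant ?_ ?_ ?_
  · have h3 : orderOf (congruenceAction (torsionGenerator true)) = 3 := by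
      refine orderOf_eq_prime congruenceAction_torsionGenerator_true_cube fun h => ?_
      have := congr_fun (congr_fun (Equiv.ext_iff.1 h !![1, 0; 0, 0]) 0) 0
      revert this
      simp [congruenceAction_apply, coe_torsionGenerator_true, Matrix.vecMul, dotProduct,
        Fin.sum_univ_two]
    have hcard : Nat.card (factor true) = 3 := (Nat.card_zpowers _).trans h3
    have : Finite (factor true) := Nat.finite_of_card_ne_zero (by omega)
    rw [← Nat.cast_card, hcard]; rfl
  · rintro (_ | _)
    · exact ⟨_, ![1, 1], rfl, by simp⟩
    · exact ⟨_, ![1, -1], rfl, by simp⟩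
  · have key : Disjoint (quadrant false) (quadrant true) := by
      refine Set.disjoint_left.2 ?_
      rintro X ⟨v, rfl, hv⟩ ⟨w, hw, hw'⟩
      have := congr_fun (congr_fun hw 0) 1
      simp only [Matrix.vecMulVec_apply] at this hv hw'
      omega
    rintro (_ | _) (_ | _) h
    · exact (h rfl).elim
    · exact key
    · exact key.symm
    · exact (h rfl).elim
  · rintro (_ | _) (_ | _) h
    · exact (h rfl).elim
    · rintro ⟨y, hy⟩ hne
      obtain ⟨m, hm, rfl⟩ := exists_pow_of_mem_zpowers two_ne_zero
        congruenceAction_torsionGenerator_false_sq hy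
      rintro _ ⟨_, ⟨v, rfl, hv⟩, rfl⟩
      simp only at hv
      interval_cases m
      · exact (hne (Subtype.ext (pow_zero _))).elim
      · simp only [Subgroup.subtype_apply, pow_one, hact]
        refine ⟨_, rfl, ?_⟩
        simp [torsionGenerator, ModularGroup.S]
        linarith
    · rintro ⟨y, hy⟩ hne
      obtain ⟨m, hm, rfl⟩ := exists_pow_of_mem_zpowers three_ne_zero
        congruenceAction_torsionGenerator_true_cube hy
      rintro _ ⟨_, ⟨v, rfl, hv⟩, rfl⟩
      simp only at hv
      interval_cases m
      · exact (hne (Subtype.ext (pow_zero _))).elim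
      · simp only [Subgroup.subtype_apply, pow_one, hact]
        refine ⟨_, rfl, ?_⟩
        simp [coe_torsionGenerator_true]
        nlinarith [sq_nonneg (v 1)]
      · simp only [Subgroup.subtype_apply, ← map_pow, hact]
        refine ⟨_, rfl, ?_⟩
        rw [coe_torsionGenerator_true_sq]
        simp
        nlinarith [sq_nonneg (v 0)]
    · exact (h rfl).elim

theorem congruenceAction_mem_range (g : SL(2, ℤ)) : congruenceAction g ∈ freeProductHom.range := by
  have hgen : ∀ i, congruenceAction (torsionGenerator i) ∈ freeProductHom.range := fun i =>
    ⟨CoprodI.of (i := i) ⟨_, Subgroup.mem_zpowers _⟩, CoprodI.lift_of _ _⟩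
  have hS := hgen false
  have hT := (freeProductHom.range).mul_mem ((freeProductHom.range).inv_mem hS) (hgen true)
  rw [← map_inv, ← map_mul] at hT
  simp only [torsionGenerator, inv_mul_cancel_left] at hS hT
  have hle : Subgroup.closure {ModularGroup.S, ModularGroup.T} ≤
      freeProductHom.range.comap congruenceAction := by
    rw [Subgroup.closure_le]
    rintro x (rfl | rfl)
    · exact hS
    · exact hT
  rw [SpecialLinearGroup.SL2Z_generators] at hle
  exact hle (Subgroup.mem_top g)

/-- `Γ(p)` embeds in `PSL₂(ℤ) = C₂ * C₃` and, being torsion free, misses the conjugates of both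
factors. -/
theorem isFreeGroup_Gamma {p : ℕ} (hp : 3 ≤ p) : IsFreeGroup (Gamma p) := by
  have hinj : Function.Injective (congruenceAction.comp (Gamma p).subtype) := by
    rw [injective_iff_map_eq_one]
    exact fun g hg => Subtype.ext (eq_one_of_congruenceAction_eq_one hp g.2 hg)
  -- the embedding of `Γ(p)` in the free product
  let j : Gamma p →* CoprodI (fun i => factor i) :=
    (MonoidHom.ofInjective freeProductHom_injective).symm.toMonoidHom.comp
      ((congruenceAction.comp (Gamma p).subtype).codRestrict _ fun g =>
        congruenceAction_mem_range g)
  have hj : ∀ g, freeProductHom (j g) = congruenceAction g := fun g =>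
    MonoidHom.apply_ofInjective_symm freeProductHom_injective _
  have hjinj : Function.Injective j := fun a b h => hinj (by
    have := congrArg freeProductHom h
    rwa [hj, hj] at this)
  have htor : ∀ (n : ℕ), (∀ g ∈ Gamma p, g ^ n = 1 → g = 1) → ∀ t (i : Bool) (h : factor i),
      h ^ n = 1 → t * CoprodI.of (M := fun i => factor i) h * t⁻¹ ∈ j.range → h = 1 := by
    rintro n hn t i h hh ⟨g, hg⟩
    have h1 : j (g ^ n) = 1 := by
      rw [map_pow, hg, conj_pow, ← map_pow, hh]; simp
    have h2 : g ^ n = 1 := hjinj (by rw [h1, map_one])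
    have h3 : g = 1 := Subtype.ext (hn g g.2 (by simpa using congrArg Subtype.val h2))
    rw [h3, map_one, eq_comm, conj_eq_one_iff] at hg
    exact CoprodI.of_injective (M := fun i => factor i) i (by rw [hg, map_one])
  have : IsFreeGroup j.range := isFreeGroup_of_forall_conj j.range (by
    rintro t (_ | _) h
    · refine htor 2 (fun g hg => eq_one_of_sq_eq_one hp hg) t _ h ?_
      obtain ⟨k, hk⟩ := Subgroup.mem_zpowers_iff.1 h.2
      apply Subtype.ext
      rw [Subgroup.coe_pow, ← hk, ← zpow_natCast, zpow_comm, zpow_natCast,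
        congruenceAction_torsionGenerator_false_sq, one_zpow]; rfl
    · refine htor 3 (fun g hg => eq_one_of_pow_three_eq_one hp hg) t _ h ?_
      obtain ⟨k, hk⟩ := Subgroup.mem_zpowers_iff.1 h.2
      apply Subtype.ext
      rw [Subgroup.coe_pow, ← hk, ← zpow_natCast, zpow_comm, zpow_natCast,
        congruenceAction_torsionGenerator_true_cube, one_zpow]; rfl)
  exact IsFreeGroup.ofMulEquiv (MonoidHom.ofInjective hjinj).symm

end PrincipalCongruence

/-! ### Cohomology of extensions of a free group -/

open CategoryTheory groupCohomology

section WangSequence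

universe u

variable (k : Type u) {G : Type u} [CommRing k] [Group G]

/-- The representation of `G` coinduced from the trivial representation `V` of a subgroup `N`:
functions on `N \ G` with values in `V`. -/
noncomputable abbrev coindTrivial (N : Subgroup G) (V : Type u) [AddCommGroup V] [Module k V] :
    Rep.{u} k G :=
  Rep.coind N.subtype (Rep.trivial k N V)

variable {k} {N : Subgroup G} {V : Type u} [AddCommGroup V] [Module k V]

theorem coindTrivial_apply_mul (φ : coindTrivial k N V) (n : N) (g : G) :
    φ.1 (n * g) = φ.1 g := φ.2 n g

variable (k N V) in
/-- The embedding of the trivial representation as the constant functions. -/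
noncomputable def constHom : Rep.trivial k G V ⟶ coindTrivial k N V :=
  Rep.ofHom
    { toFun := fun v => ⟨fun _ => v, fun _ _ => rfl⟩
      map_add' := fun _ _ => rfl
      map_smul' := fun _ _ => rfl
      isIntertwining' := fun _ => rfl }

variable (k N V) in
/-- The difference operator `φ ↦ (φ - φ(sᵢ⁻¹ ·))ᵢ`. -/
noncomputable def diffHom [N.Normal] {ι : Type u} (s : ι → G) :
    coindTrivial k N V ⟶ coindTrivial k N (ι → V) :=
  Rep.ofHom
    { toFun := fun φ => ⟨fun g i => φ.1 g - φ.1 ((s i)⁻¹ * g), fun n g => by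
        funext i
        have h : (s i)⁻¹ * (n * g) =
            ((⟨(s i)⁻¹ * n * s i, by
              simpa using ‹N.Normal›.conj_mem n n.2 (s i)⁻¹⟩ : N) : G) * ((s i)⁻¹ * g) := by
          simp [mul_assoc]
        have e1 := coindTrivial_apply_mul φ n g
        have e2 := coindTrivial_apply_mul φ ⟨(s i)⁻¹ * n * s i, by
              simpa using ‹N.Normal›.conj_mem n n.2 (s i)⁻¹⟩ ((s i)⁻¹ * g)
        rw [← h] at e2
        simp only [Subgroup.subtype_apply]
        rw [e1, e2]; rfl⟩
      map_add' := fun φ ψ => by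
        ext g i
        simp; abel
      map_smul' := fun c φ => by
        ext g i
        simp [smul_sub]
      isIntertwining' := fun g => by
        refine LinearMap.ext fun φ => Subtype.ext (funext fun h => funext fun i => ?_)
        exact congrArg (fun x => φ.1 (h * g) - φ.1 x) (mul_assoc _ _ _) }

theorem mem_of_forall_basis_mem {F ι : Type*} [Group F] (b : FreeGroupBasis ι F)
    (S : Subgroup F) (h : ∀ i, b i ∈ S) (a : F) : a ∈ S := by
  have hid : S.subtype.comp (b.lift fun i => (⟨b i, h i⟩ : S)) = MonoidHom.id F :=
    b.ext_hom _ _ fun i => by simp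
  rw [← MonoidHom.id_apply F a, ← hid]
  exact Subtype.property _

/-- A function on a free group is determined, up to its value at `1`, by arbitrarily prescribed
differences along the generators: the Cayley graph is a tree. -/
theorem exists_forall_sub_eq {F ι A : Type*} [Group F] [AddCommGroup A] (b : FreeGroupBasis ι F)
    (γ : ι → F → A) : ∃ β : F → A, ∀ i a, β a - β ((b i)⁻¹ * a) = γ i a := by
  let ρ : F →* Equiv.Perm (F × A) := b.lift fun i =>
    { toFun := fun z => (b i * z.1, z.2 + γ i (b i * z.1))
      invFun := fun z => ((b i)⁻¹ * z.1, z.2 - γ i z.1)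
      left_inv := fun z => by simp
      right_inv := fun z => by simp }
  have hρ : ∀ i z, ρ (b i) z = (b i * z.1, z.2 + γ i (b i * z.1)) := fun i z => by
    simp only [ρ, FreeGroupBasis.lift_apply_apply, FreeGroupBasis.repr_apply_coe,
      FreeGroup.lift_apply_of]; rfl
  have hfst : ∀ a z, (ρ a z).1 = a * z.1 := by
    let S : Subgroup F :=
      { carrier := {a | ∀ z, (ρ a z).1 = a * z.1}
        one_mem' := fun z => by simp
        mul_mem' := fun {x y} hx hy z => by
          rw [map_mul, Equiv.Perm.mul_apply, hx, hy, mul_assoc]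
        inv_mem' := fun {x} hx z => by
          have := hx (ρ x⁻¹ z)
          rw [← Equiv.Perm.mul_apply, ← map_mul] at this
          rw [eq_inv_mul_iff_mul_eq, ← this]; simp }
    exact fun a => mem_of_forall_basis_mem b S (fun i z => by rw [hρ]) a
  refine ⟨fun a => (ρ a (1, 0)).2, fun i a => ?_⟩
  have h1 : ρ a (1, 0) = ρ (b i) (ρ ((b i)⁻¹ * a) (1, 0)) := by
    rw [← Equiv.Perm.mul_apply, ← map_mul, mul_inv_cancel_left]
  simp only [h1, hρ, hfst]
  simp

variable {F ι : Type u} [Group F] (b : FreeGroupBasis ι F) (q : G →* F)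

variable (k V) in
/-- For `q : G → F` with `F` free on the images of the `sᵢ`, the complex
`0 → V → Coind V → Coind (ι → V) → 0`, with coinduction from `ker q`. -/
noncomputable def wangComplex (s : ι → G) : ShortComplex (Rep.{u} k G) where
  X₁ := Rep.trivial k G V
  X₂ := coindTrivial k q.ker V
  X₃ := coindTrivial k q.ker (ι → V)
  f := constHom k q.ker V
  g := diffHom k q.ker V s
  zero := by
    ext v g i
    exact sub_self v

theorem eq_of_forall_generator {F ι : Type*} [Group F] (b : FreeGroupBasis ι F)
    {A : Type*} (φ : F → A) (h : ∀ i a, φ ((b i)⁻¹ * a) = φ a) (a : F) : φ a = φ 1 := by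
  let S : Subgroup F :=
    { carrier := {x | ∀ a, φ (x * a) = φ a}
      one_mem' := fun a => by simp
      mul_mem' := fun {x y} hx hy a => by rw [mul_assoc, hx, hy]
      inv_mem' := fun {x} hx a => by rw [← hx, mul_inv_cancel_left] }
  simpa using mem_of_forall_basis_mem b S (fun i a => by rw [← h i, inv_mul_cancel_left]) a 1

theorem wangComplex_shortExact (hq : Function.Surjective q) (s : ι → G)
    (hs : ∀ i, q (s i) = b i) : (wangComplex k V q s).ShortExact where
  exact := (forget₂ (Rep.{u} k G) (ModuleCat k)).reflects_exact_of_faithful _ <|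
    (ShortComplex.moduleCat_exact_iff _).2 fun (φ : coindTrivial k q.ker V) hφ => by
      have hφ' : ∀ g i, φ.1 ((s i)⁻¹ * g) = φ.1 g := fun g i =>
        (sub_eq_zero.1 (congr_fun (congr_fun (congrArg Subtype.val hφ) g) i)).symm
      have hfac : ∀ g h, q g = q h → φ.1 g = φ.1 h := fun g h e => by
        have := coindTrivial_apply_mul φ ⟨g * h⁻¹, by simp [MonoidHom.mem_ker, e]⟩ h
        simpa using this
      have hconst := eq_of_forall_generator b (fun a => φ.1 (Function.surjInv hq a))
        fun i a => by
          rw [← hφ' (Function.surjInv hq a) i]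
          exact hfac _ _ (by simp [Function.surjInv_eq, hs])
      refine ⟨(φ.1 (Function.surjInv hq 1) : V), Subtype.ext (funext fun g => ?_)⟩
      refine ((hconst (q g)).symm).trans (hfac _ _ (Function.surjInv_eq hq _))
  mono_f := (Rep.mono_iff_injective _).2 fun (v w : V) h => congr_fun (congrArg Subtype.val h) 1
  epi_g := (Rep.epi_iff_surjective _).2 fun (ψ : coindTrivial k q.ker (ι → V)) => by
    obtain ⟨β, hβ⟩ := exists_forall_sub_eq b fun i a => ψ.1 (Function.surjInv hq a) i
    refine ⟨(⟨fun g => β (q g), fun n g => ?_⟩ : coindTrivial k q.ker V),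
      Subtype.ext (funext fun g => funext fun i => ?_)⟩
    · have : q n = 1 := n.2
      simp [this]
    · have := hβ i (q g)
      have h2 := coindTrivial_apply_mul ψ ⟨Function.surjInv hq (q g) * g⁻¹, by
        simp [MonoidHom.mem_ker, Function.surjInv_eq]⟩ g
      rw [inv_mul_cancel_right] at h2
      rw [h2] at this
      rw [← this, ← hs, ← map_inv, ← map_mul]
      rfl

variable (k N V) in
/-- The map on cohomology induced by the inclusion of the constant functions. -/
noncomputable def constMap (n : ℕ) : groupCohomology (Rep.trivial k G V) n →ₗ[k]
    groupCohomology (coindTrivial k N V) n :=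
  ((functor k G n).map (constHom k N V)).hom

variable (k N V) in
/-- The map on cohomology induced by the difference operator. -/
noncomputable def diffMap [N.Normal] {ι : Type u} (s : ι → G) (n : ℕ) :
    groupCohomology (coindTrivial k N V) n →ₗ[k] groupCohomology (coindTrivial k N (ι → V)) n :=
  ((functor k G n).map (diffHom k N V s)).hom

variable (k V) in
/-- The long exact cohomology sequence of `wangComplex`. -/
theorem exists_wang_sequence (hq : Function.Surjective q) (s : ι → G)
    (hs : ∀ i, q (s i) = b i) (n : ℕ) :
    ∃ d : groupCohomology (coindTrivial k q.ker (ι → V)) n →ₗ[k]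
        groupCohomology (Rep.trivial k G V) (n + 1),
      Function.Exact (constMap k q.ker V n) (diffMap k q.ker V s n) ∧
      Function.Exact (diffMap k q.ker V s n) d ∧
      Function.Exact d (constMap k q.ker V (n + 1)) := by
  have hX := wangComplex_shortExact (k := k) (V := V) b q hq s hs
  exact ⟨(δ hX n (n + 1) rfl).hom,
    (ShortComplex.ShortExact.moduleCat_exact_iff_function_exact _).1 (mapShortComplex₂_exact hX n),
    (ShortComplex.ShortExact.moduleCat_exact_iff_function_exact _).1
      (mapShortComplex₃_exact hX rfl),
    (ShortComplex.ShortExact.moduleCat_exact_iff_function_exact _).1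
      (mapShortComplex₁_exact hX rfl)⟩

theorem subsingleton_coindTrivial (N : Subgroup G) {n : ℕ}
    (h : Subsingleton (groupCohomology (Rep.trivial k N V) n)) :
    Subsingleton (groupCohomology (coindTrivial k N V) n) :=
  (coindIso (Rep.trivial k N V) n).toLinearEquiv.toEquiv.subsingleton

/-- For trivial coefficients, an extension of a free group by `N` has cohomological dimension at most
one more than `N`. -/
theorem subsingleton_cohomology_succ {F ι : Type u} [Group F] (b : FreeGroupBasis ι F)
    (q : G →* F) (hq : Function.Surjective q) {n : ℕ}
    (h : ∀ (V : Type u) [AddCommGroup V] [Module k V] (m : ℕ), n ≤ m →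
      Subsingleton (groupCohomology (Rep.trivial k q.ker V) m))
    (V : Type u) [AddCommGroup V] [Module k V] {m : ℕ} (hm : n + 1 ≤ m) :
    Subsingleton (groupCohomology (Rep.trivial k G V) m) := by
  obtain ⟨m, rfl⟩ : ∃ l, m = l + 1 := ⟨m - 1, by omega⟩
  obtain ⟨d, -, -, h3⟩ := exists_wang_sequence k V b q hq (fun i => Function.surjInv hq (b i))
    (fun i => Function.surjInv_eq hq _) m
  have h1 := subsingleton_coindTrivial q.ker (h (ι → V) m (by omega))
  have h2 := subsingleton_coindTrivial q.ker (h V (m + 1) (by omega))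
  refine subsingleton_of_forall_eq 0 fun x => ?_
  obtain ⟨y, rfl⟩ := (h3 x).1 (h2.elim _ _)
  rw [Subsingleton.elim y 0, map_zero]

/-- Two quotients of a module by the same kernel are isomorphic. -/
theorem exists_linearEquiv_of_ker_eq {Z A B : Type*} [AddCommGroup Z] [AddCommGroup A]
    [AddCommGroup B] [Module k Z] [Module k A] [Module k B] (f : Z →ₗ[k] A) (g : Z →ₗ[k] B)
    (hf : Function.Surjective f) (hg : Function.Surjective g)
    (h : ∀ z, f z = 0 ↔ g z = 0) : ∃ e : A ≃ₗ[k] B, ∀ z, e (f z) = g z := by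
  have hker : LinearMap.ker f = LinearMap.ker g := Submodule.ext fun z => by simp [h]
  refine ⟨((f.quotKerEquivOfSurjective hf).symm.trans (Submodule.quotEquivOfEq _ _ hker)).trans
    (g.quotKerEquivOfSurjective hg), fun z => ?_⟩
  have : (f.quotKerEquivOfSurjective hf).symm (f z) = Submodule.Quotient.mk z := by
    rw [LinearEquiv.symm_apply_eq]; rfl
  simp [this]

/-- Shapiro's lemma in degree one for trivial coefficients, with its value on cocycles. -/
theorem exists_H1_coindTrivial_equiv (N : Subgroup G) :
    ∃ e : H1 (coindTrivial k N V) ≃ₗ[k] (Additive N →+ V),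
      ∀ (f : cocycles₁ (coindTrivial k N V)) (n : N),
        e (H1π _ f) (Additive.ofMul n) = (f (n : G)).1 1 := by
  have hval : ∀ (f : cocycles₁ (coindTrivial k N V)) (g h x : G),
      (f (g * h)).1 x = (f h).1 (x * g) + (f g).1 x := fun f g h x =>
    congr_fun (congrArg Subtype.val ((mem_cocycles₁_iff f).1 f.2 g h)) x
  have hinv : ∀ (φ : coindTrivial k N V) (n : N), φ.1 n = φ.1 1 := fun φ n => by
    simpa using coindTrivial_apply_mul φ n 1
  let ev : cocycles₁ (coindTrivial k N V) →ₗ[k] (Additive N →+ V) :=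
    { toFun := fun f => AddMonoidHom.mk' (fun n => (f (n.toMul : G)).1 1) fun m n => by
        rw [toMul_add, Subgroup.coe_mul, hval, one_mul, hinv, add_comm]
      map_add' := fun f g => rfl
      map_smul' := fun c f => rfl }
  have hsurj : Function.Surjective ev := by
    intro m
    obtain ⟨t, ht, -⟩ := exists_equivariant_coordinate N ⊥ (by
      rintro t k hk -
      simpa using hk)
    let β : G → V := fun g => m (Additive.ofMul (t g))
    have hβ : ∀ (n : N) g, β (n * g) = m (Additive.ofMul n) + β g := fun n g => by
      simp only [β, ht, ofMul_mul, map_add]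
    refine ⟨⟨fun g => ⟨fun x => β (x * g) - β x, fun n x => ?_⟩, ?_⟩, ?_⟩
    · simp only [Subgroup.subtype_apply, mul_assoc, hβ]
      simp
    · refine (mem_cocycles₁_iff _).2 fun g h => Subtype.ext (funext fun x => ?_)
      change β (x * (g * h)) - β x = (β (x * g * h) - β (x * g)) + (β (x * g) - β x)
      rw [mul_assoc]; abel
    · ext n
      change β (1 * (n : G)) - β 1 = m (Additive.ofMul n)
      have := hβ n 1
      rw [mul_one] at this
      rw [one_mul, this]; simp
  have hker : ∀ f, (H1π (coindTrivial k N V)).hom f = 0 ↔ ev f = 0 := by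
    intro f
    refine (H1π_eq_zero_iff f).trans ⟨?_, fun h => ?_⟩
    · rintro ⟨φ, hφ⟩
      ext n
      have := congr_fun (congrArg Subtype.val (congr_fun hφ (n : G))) 1
      refine this.symm.trans ?_
      change φ.1 (1 * (n : G)) - φ.1 1 = 0
      rw [one_mul, hinv, sub_self]
    · have hz : ∀ n : N, (f (n : G)).1 1 = 0 := fun n =>
        DFunLike.congr_fun h (Additive.ofMul n)
      refine ⟨(⟨fun x => (f x).1 1, fun n x => ?_⟩ : coindTrivial k N V),
        funext fun g => Subtype.ext (funext fun x => ?_)⟩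
      · change (f (n * x)).1 1 = (f x).1 1
        rw [hval, one_mul, hinv, hz, add_zero]
      · change (f (x * g)).1 1 - (f x).1 1 = (f g).1 x
        rw [hval, one_mul, add_sub_cancel_right]
  obtain ⟨e, he⟩ := exists_linearEquiv_of_ker_eq (H1π (coindTrivial k N V)).hom ev
    ((ModuleCat.epi_iff_surjective _).1 inferInstance) hsurj hker
  exact ⟨e, fun f n => DFunLike.congr_fun (he f) (Additive.ofMul n)⟩

theorem exists_map_H1π {A B : Rep.{u} k G} (φ : A ⟶ B) 
    (f : cocycles₁ A) :
    ∃ f' : cocycles₁ B, (∀ g, f' g = φ.hom (f g)) ∧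
      ((functor k G 1).map φ).hom (H1π A f) = H1π B f' :=
  ⟨mapCocycles₁ (MonoidHom.id G) φ f, fun g =>
      congr_fun (coe_mapCocycles₁ (f := MonoidHom.id G) (φ := φ) f) g,
    H1π_comp_map_apply (MonoidHom.id G) φ f⟩

theorem exists_map_H2π {A B : Rep.{u} k G} (φ : A ⟶ B) 
    (f : cocycles₂ A) :
    ∃ f' : cocycles₂ B, (∀ g h, f' (g, h) = φ.hom (f (g, h))) ∧
      ((functor k G 2).map φ).hom (H2π A f) = H2π B f' :=
  ⟨mapCocycles₂ (MonoidHom.id G) φ f, fun g h =>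
      congr_fun (coe_mapCocycles₂ (f := MonoidHom.id G) (φ := φ) f) (g, h),
    H2π_comp_map_apply (MonoidHom.id G) φ f⟩

/-- On `H¹(N, V) = Hom(N, V)` the difference operator is `m ↦ (m - m(sᵢ⁻¹ · sᵢ))ᵢ`. -/
theorem H1_equiv_diffMap_apply [N.Normal] (s : ι → G)
    (e : H1 (coindTrivial k N V) ≃ₗ[k] (Additive N →+ V))
    (he : ∀ (f : cocycles₁ (coindTrivial k N V)) (n : N),
        e (H1π _ f) (Additive.ofMul n) = (f (n : G)).1 1)
    (e' : H1 (coindTrivial k N (ι → V)) ≃ₗ[k] (Additive N →+ (ι → V)))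
    (he' : ∀ (f : cocycles₁ (coindTrivial k N (ι → V))) (n : N),
        e' (H1π _ f) (Additive.ofMul n) = (f (n : G)).1 1)
    (x : H1 (coindTrivial k N V)) (n m : N) (i : ι) (hm : (m : G) = (s i)⁻¹ * n * s i) :
    e' (diffMap k N V s 1 x) (Additive.ofMul n) i =
      e x (Additive.ofMul n) - e x (Additive.ofMul m) := by
  induction x using H1_induction_on with | h f => ?_
  have hval : ∀ (g h x : G),
      (f (g * h)).1 x = (f h).1 (x * g) + (f g).1 x := fun g h x =>
    congr_fun (congrArg Subtype.val ((mem_cocycles₁_iff f).1 f.2 g h)) x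
  obtain ⟨f', hf', h1⟩ := exists_map_H1π (diffHom k N V s) f
  have h2 : diffMap k N V s 1 (H1π _ f) = H1π _ f' := h1
  rw [h2, he', he, he, hf']
  change (f (n : G)).1 1 - (f (n : G)).1 ((s i)⁻¹ * 1) = _
  congr 1
  have e1 := hval (s i)⁻¹ n 1
  have e2 := hval m (s i)⁻¹ 1
  have e3 : (m : G) * (s i)⁻¹ = (s i)⁻¹ * n := by rw [hm]; group
  rw [e3, e1] at e2
  have e4 : (f (s i)⁻¹).1 (1 * m) = (f (s i)⁻¹).1 1 := by
    simpa using coindTrivial_apply_mul (f (s i)⁻¹) m 1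
  rw [e4, add_comm] at e2
  rw [mul_one]
  simpa using add_left_cancel e2

end WangSequence

/-! ### Free groups and free abelian groups of rank two -/

section FreeGroupCohomology

variable {k F ι : Type} [CommRing k] [Group F] (b : FreeGroupBasis ι F) (A : Rep.{0} k F)

/-- The difference operator `x ↦ (x - bᵢ x)ᵢ` of a representation of a free group. -/
def generatorDiff : A.V →ₗ[k] (ι → A.V) := LinearMap.pi fun i => LinearMap.id - A.ρ (b i)

theorem generatorDiff_apply (x : A.V) (i : ι) : generatorDiff b A x i = x - A.ρ (b i) x := rfl

/-- A crossed homomorphism on a free group may be prescribed on the generators: it is the orbit of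
`0` under the action by affine maps `x ↦ bᵢ x + mᵢ`. -/
theorem exists_cocycle_of_generators (m : ι → A.V) : ∃ f : cocycles₁ A, ∀ i, f (b i) = m i := by
  let aff : F →* Equiv.Perm A.V := b.lift fun i =>
    { toFun := fun x => A.ρ (b i) x + m i
      invFun := fun x => A.ρ (b i)⁻¹ (x - m i)
      left_inv := fun x => by simp
      right_inv := fun x => by simp }
  have haff : ∀ i x, aff (b i) x = A.ρ (b i) x + m i := fun i x => by
    simp only [aff, FreeGroupBasis.lift_apply_apply, FreeGroupBasis.repr_apply_coe,
      FreeGroup.lift_apply_of]; rfl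
  let S : Subgroup F :=
    { carrier := {a | ∀ x, aff a x = A.ρ a x + aff a 0}
      one_mem' := fun x => by simp
      mul_mem' := fun {g h} hg hh x => by
        simp only [map_mul, Equiv.Perm.mul_apply]
        rw [hh x, hg (A.ρ h x + aff h 0), hg (aff h 0)]
        simp [add_assoc]
      inv_mem' := fun {g} hg x => by
        have h1 := hg (aff g⁻¹ x)
        have h2 := hg (aff g⁻¹ 0)
        rw [← Equiv.Perm.mul_apply, ← map_mul, mul_inv_cancel, map_one,
          Equiv.Perm.one_apply] at h1 h2
        have h3 : x = A.ρ g (aff g⁻¹ x - aff g⁻¹ 0) := by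
          rw [map_sub, eq_sub_of_add_eq h1.symm, eq_sub_of_add_eq h2.symm]; simp
        conv_rhs => rw [h3]
        simp }
  have hS : ∀ a x, aff a x = A.ρ a x + aff a 0 := mem_of_forall_basis_mem b S fun i x => by
    rw [haff, haff]; simp
  refine ⟨⟨fun a => aff a 0, (mem_cocycles₁_iff _).2 fun g h => ?_⟩, fun i => ?_⟩
  · rw [map_mul, Equiv.Perm.mul_apply, hS]
  · exact (haff i 0).trans (by simp)

theorem cocycle_eq_zero_of_generators (f : cocycles₁ A) (h : ∀ i, f (b i) = 0) : f = 0 := by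
  have hf := (mem_cocycles₁_iff f).1 f.2
  let S : Subgroup F :=
    { carrier := {a | f a = 0}
      one_mem' := cocycles₁_map_one f
      mul_mem' := fun {g h} (hg : f g = 0) (hh : f h = 0) => by
        change f (g * h) = 0
        rw [hf, hg, hh]; simp
      inv_mem' := fun {g} (hg : f g = 0) => by
        change f g⁻¹ = 0
        have h1 := cocycles₁_map_inv f g
        rw [hg, neg_zero] at h1
        have h2 := congrArg (A.ρ g⁻¹) h1
        rwa [Representation.inv_self_apply, map_zero] at h2 }
  exact cocycles₁_ext fun g => mem_of_forall_basis_mem b S h g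

theorem nonempty_H1_equiv_quotient_range (b : FreeGroupBasis ι F) (A : Rep.{0} k F) :
    Nonempty (H1 A ≃ₗ[k] ((ι → A.V) ⧸ LinearMap.range (generatorDiff b A))) := by
  let ev : cocycles₁ A →ₗ[k] (ι → A.V) :=
    { toFun := fun f i => f (b i)
      map_add' := fun _ _ => rfl
      map_smul' := fun _ _ => rfl }
  have hsurj : Function.Surjective ev := fun m => by
    obtain ⟨f, hf⟩ := exists_cocycle_of_generators b A m
    exact ⟨f, funext hf⟩
  obtain ⟨e, -⟩ := exists_linearEquiv_of_ker_eq (H1π A).hom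
    ((LinearMap.range (generatorDiff b A)).mkQ.comp ev)
    ((ModuleCat.epi_iff_surjective _).1 inferInstance)
    ((Submodule.mkQ_surjective _).comp hsurj) fun f => by
      refine (H1π_eq_zero_iff f).trans (Iff.trans ?_ (Submodule.Quotient.mk_eq_zero _).symm)
      constructor
      · rintro ⟨x, hx⟩
        refine ⟨-x, funext fun i => ?_⟩
        have := congr_fun hx (b i)
        rw [generatorDiff_apply]
        refine Eq.trans ?_ this
        change _ = A.ρ (b i) x - x
        rw [map_neg]; abel
      · rintro ⟨x, hx⟩
        refine ⟨-x, ?_⟩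
        have h0 : (⟨_, d₀₁_apply_mem_cocycles₁ (-x)⟩ : cocycles₁ A) - f = 0 :=
          cocycle_eq_zero_of_generators b A _ fun i => by
            have := congr_fun hx i
            rw [generatorDiff_apply] at this
            change (A.ρ (b i) (-x) - (-x)) - f (b i) = 0
            rw [sub_eq_zero]
            refine Eq.trans ?_ this
            rw [map_neg]; abel
        exact congrArg Subtype.val (sub_eq_zero.1 h0)
  exact ⟨e⟩

theorem nonempty_H1_trivial_equiv (b : FreeGroupBasis ι F) (V : Type) [AddCommGroup V] [Module k V] :
    Nonempty (H1 (Rep.trivial k F V) ≃ₗ[k] (ι → V)) := by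
  obtain ⟨e⟩ := nonempty_H1_equiv_quotient_range b (Rep.trivial k F V)
  refine ⟨e.trans (Submodule.quotEquivOfEqBot _ ?_)⟩
  rw [LinearMap.range_eq_bot]
  ext x i
  exact sub_self x

end FreeGroupCohomology

section FreeAbelian

variable {k G : Type} [CommRing k] [Group G]

/-- The infinite cyclic group is free on one generator. -/
def intBasis : FreeGroupBasis Unit (Multiplicative ℤ) :=
  .ofRepr (MulEquiv.symm
    { toFun := FreeGroup.lift fun _ => Multiplicative.ofAdd 1
      invFun := zpowersHom _ (FreeGroup.of ())
      left_inv := fun x => by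
        have : (zpowersHom (FreeGroup Unit) (FreeGroup.of ())).comp
          (FreeGroup.lift fun _ => Multiplicative.ofAdd 1) = MonoidHom.id _ :=
          FreeGroup.ext_hom _ _ fun i => by simp [zpowersHom_apply]
        exact DFunLike.congr_fun this x
      right_inv := fun x => by
        rw [zpowersHom_apply, map_zpow, FreeGroup.lift_apply_of, ← ofAdd_zsmul]; simp
      map_mul' := map_mul _ })

theorem subsingleton_cohomology_of_int (e : G ≃* Multiplicative ℤ) (V : Type) [AddCommGroup V]
    [Module k V] {m : ℕ} (hm : 2 ≤ m) : Subsingleton (groupCohomology (Rep.trivial k G V) m) := by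
  refine subsingleton_cohomology_succ intBasis e.toMonoidHom e.surjective (n := 1)
    (fun W _ _ m hm => ?_) V hm
  have : Subsingleton e.toMonoidHom.ker :=
    ⟨fun x y => Subtype.ext (e.injective (x.2.trans y.2.symm))⟩
  obtain ⟨m, rfl⟩ : ∃ l, m = l + 1 := ⟨m - 1, by omega⟩
  exact ModuleCat.subsingleton_of_isZero (isZero_groupCohomology_succ_of_subsingleton _ m)

/-- The second coordinate, as a homomorphism to `ℤ`, of a free abelian group of rank two. -/
def sndHom (e : G ≃* Multiplicative (Fin 2 → ℤ)) : G →* Multiplicative ℤ :=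
  (AddMonoidHom.toMultiplicative (Pi.evalAddMonoidHom (fun _ => ℤ) 1)).comp e.toMonoidHom

theorem sndHom_surjective (e : G ≃* Multiplicative (Fin 2 → ℤ)) :
    Function.Surjective (sndHom e) := fun n =>
  ⟨e.symm (Multiplicative.ofAdd fun _ => n.toAdd), by simp [sndHom]⟩

/-- The kernel of the second coordinate is infinite cyclic. -/
def kerSndEquiv (e : G ≃* Multiplicative (Fin 2 → ℤ)) : (sndHom e).ker ≃* Multiplicative ℤ where
  toFun g := Multiplicative.ofAdd ((e g).toAdd 0)
  invFun n := ⟨e.symm (Multiplicative.ofAdd ![n.toAdd, 0]), by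
    rw [MonoidHom.mem_ker]; simp [sndHom]⟩
  left_inv g := by
    have hg : (e g).toAdd 1 = 0 := g.2
    apply Subtype.ext
    rw [MulEquiv.symm_apply_eq]
    apply Multiplicative.toAdd.injective
    funext i
    fin_cases i
    · rfl
    · exact hg.symm
  right_inv n := by simp
  map_mul' g h := by simp

theorem subsingleton_cohomology_of_int_sq (e : G ≃* Multiplicative (Fin 2 → ℤ)) (V : Type)
    [AddCommGroup V] [Module k V] {m : ℕ} (hm : 3 ≤ m) :
    Subsingleton (groupCohomology (Rep.trivial k G V) m) :=
  subsingleton_cohomology_succ intBasis (sndHom e) (sndHom_surjective e) (n := 2)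
    (fun W _ _ _ hm => subsingleton_cohomology_of_int (kerSndEquiv e) W hm) V hm

theorem nonempty_hom_equiv_of_int (e : G ≃* Multiplicative ℤ) (V : Type)
    [AddCommGroup V] [Module k V] : Nonempty ((Additive G →+ V) ≃ₗ[k] V) := by
  let ev : (Additive G →+ V) →ₗ[k] V :=
    { toFun := fun f => f (Additive.ofMul (e.symm (Multiplicative.ofAdd 1)))
      map_add' := fun _ _ => rfl
      map_smul' := fun _ _ => rfl }
  have hgen : ∀ g : G, Additive.ofMul g =
      (e g).toAdd • Additive.ofMul (e.symm (Multiplicative.ofAdd 1)) := fun g => by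
    rw [← ofMul_zpow, ← map_zpow, ← ofAdd_zsmul]; simp
  refine ⟨LinearEquiv.ofBijective ev ⟨?_, fun v => ?_⟩⟩
  · rw [← LinearMap.ker_eq_bot, LinearMap.ker_eq_bot']
    intro f hf
    ext g
    have : f (Additive.ofMul g) = 0 := by
      rw [hgen g, map_zsmul]
      exact (congrArg _ hf).trans (smul_zero _)
    exact this
  · refine ⟨((zmultiplesHom V v).comp (AddMonoidHom.mk' (fun g => (e g.toMul).toAdd)
      fun g h => by simp)), ?_⟩
    change (e (e.symm (Multiplicative.ofAdd 1))).toAdd • v = v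
    simp

/-- Conjugation is trivial in an abelian group, so the difference operator vanishes in degree one. -/
theorem nonempty_H2_equiv_of_int_sq (e : G ≃* Multiplicative (Fin 2 → ℤ)) (V : Type)
    [AddCommGroup V] [Module k V] : Nonempty (H2 (Rep.trivial k G V) ≃ₗ[k] V) := by
  let q := sndHom e
  let s : Unit → G := fun i => Function.surjInv (sndHom_surjective e) (intBasis i)
  obtain ⟨d, -, h2, h3⟩ := exists_wang_sequence k V intBasis q (sndHom_surjective e) s
    (fun i => Function.surjInv_eq _ _) 1
  obtain ⟨e₁, he₁⟩ := exists_H1_coindTrivial_equiv (k := k) (V := V) q.ker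
  obtain ⟨e₂, he₂⟩ := exists_H1_coindTrivial_equiv (k := k) (V := Unit → V) q.ker
  have hcomm : ∀ g h : G, g * h = h * g := fun g h => e.injective (by
    rw [map_mul, map_mul, mul_comm])
  have hzero : ∀ x, diffMap k q.ker V s 1 x = 0 := fun x => by
    apply e₂.injective
    rw [map_zero]
    ext n i
    have := H1_equiv_diffMap_apply s e₁ he₁ e₂ he₂ x n n i (by rw [mul_assoc, hcomm n]; simp)
    rw [sub_self] at this
    exact this
  have hsub := subsingleton_coindTrivial (k := k) (V := V) q.ker
    (subsingleton_cohomology_of_int (k := k) (kerSndEquiv e) V le_rfl)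
  have hbij : Function.Bijective d := by
    constructor
    · rw [← LinearMap.ker_eq_bot, LinearMap.ker_eq_bot']
      intro x hx
      obtain ⟨y, rfl⟩ := (h2 x).1 hx
      exact hzero y
    · intro x
      exact (h3 x).1 (hsub.elim _ _)
  obtain ⟨e₃⟩ := nonempty_hom_equiv_of_int (k := k) (kerSndEquiv e) (Unit → V)
  exact ⟨((LinearEquiv.ofBijective d hbij).symm.trans (e₂.trans e₃)).trans
    (LinearEquiv.funUnique Unit k V)⟩

end FreeAbelian

/-! ### Extensions of a free group by a free abelian group of rank two -/

section FreeByAbelian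

/-- Homomorphisms to a product of modules. -/
def homPiEquiv {k M ι V : Type*} [CommRing k] [AddGroup M] [AddCommGroup V] [Module k V] :
    (M →+ (ι → V)) ≃ₗ[k] (ι → (M →+ V)) where
  toFun f i := (Pi.evalAddMonoidHom (fun _ => V) i).comp f
  invFun g := AddMonoidHom.mk' (fun m i => g i m) fun m n => by ext i; simp
  left_inv _ := rfl
  right_inv _ := rfl
  map_add' _ _ := rfl
  map_smul' _ _ := rfl

/-- An exact sequence ending in a nonzero map to the ring splits off a copy of the ring. -/
theorem nonempty_equiv_quotient_range_prod {k A B C : Type*} [CommRing k] [IsDomain k]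
    [IsPrincipalIdealRing k] [AddCommGroup A] [AddCommGroup B] [AddCommGroup C] [Module k A]
    [Module k B] [Module k C] (a : A →ₗ[k] B) (d : B →ₗ[k] C) (c : C →ₗ[k] k)
    (h1 : Function.Exact a d) (h2 : Function.Exact d c) (hc : c ≠ 0) :
    Nonempty (C ≃ₗ[k] ((B ⧸ LinearMap.range a) × k)) := by
  -- `c c₀` generates the image of `c`, and `c₀` spans the split summand
  obtain ⟨r, hr⟩ := IsPrincipalIdealRing.principal (LinearMap.range c)
  obtain ⟨c₀, rfl⟩ : r ∈ LinearMap.range c := hr ▸ Submodule.mem_span_singleton_self r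
  have hne : c c₀ ≠ 0 := fun h => hc (by
    rw [h] at hr
    rw [← LinearMap.range_eq_bot, hr]; simp)
  have hker : LinearMap.range a = LinearMap.ker d := h1.linearMap_ker_eq.symm
  let d' : (B ⧸ LinearMap.range a) →ₗ[k] C := (LinearMap.range a).liftQ d hker.le
  have hd' : ∀ x, d' (Submodule.Quotient.mk x) = d x := fun x => Submodule.liftQ_apply _ _ _
  let f : ((B ⧸ LinearMap.range a) × k) →ₗ[k] C :=
    d'.coprod (LinearMap.toSpanSingleton k C c₀)
  have hf : ∀ x n, f (Submodule.Quotient.mk x, n) = d x + n • c₀ := fun x n => by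
    simp [f, hd']
  refine ⟨(LinearEquiv.ofBijective f ⟨?_, fun y => ?_⟩).symm⟩
  · rw [← LinearMap.ker_eq_bot, LinearMap.ker_eq_bot']
    rintro ⟨x, n⟩ hx
    obtain ⟨x, rfl⟩ := Submodule.Quotient.mk_surjective _ x
    rw [hf] at hx
    have h0 := congrArg c hx
    rw [map_add, h2.apply_apply_eq_zero, zero_add, map_smul, map_zero, smul_eq_mul] at h0
    obtain rfl : n = 0 := (mul_eq_zero.1 h0).resolve_right hne
    rw [zero_smul, add_zero] at hx
    refine Prod.ext ((Submodule.Quotient.mk_eq_zero _).2 ?_) rfl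
    rw [hker]; exact hx
  · have hy : c y ∈ Submodule.span k {c c₀} := hr ▸ LinearMap.mem_range_self c y
    obtain ⟨n, hn⟩ := Submodule.mem_span_singleton.1 hy
    obtain ⟨x, hx⟩ := (h2 (y - n • c₀)).1 (by rw [map_sub, map_smul, hn, sub_self])
    exact ⟨(Submodule.Quotient.mk x, n), by rw [hf, hx, sub_add_cancel]⟩

/-- A 2-cocycle whose restriction to `N` is not symmetric on some commuting pair is not killed by
restriction to `N`. -/
theorem constMap_H2π_ne_zero {k G V : Type} [CommRing k] [Group G] [AddCommGroup V] [Module k V]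
    {N : Subgroup G} (u : cocycles₂ (Rep.trivial k G V)) (x y : N) (hxy : x * y = y * x)
    (hu : u ((x : G), (y : G)) ≠ u ((y : G), (x : G))) :
    constMap k N V 2 (H2π _ u) ≠ 0 := by
  intro h
  obtain ⟨u', hu', h1⟩ := exists_map_H2π (constHom k N V) u
  obtain ⟨f, hf⟩ := (H2π_eq_zero_iff u').1 (h1.symm.trans h)
  have key : ∀ x y : N, u ((x : G), (y : G)) = (f (y : G)).1 1 - (f ((x : G) * y)).1 1 +
      (f (x : G)).1 1 := fun x y => by
    have e1 := congr_fun (congrArg Subtype.val (congr_fun hf ((x : G), (y : G)))) 1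
    have e2 := congr_fun (congrArg Subtype.val (hu' x y)) 1
    have e3 : (f (y : G)).1 (1 * (x : G)) = (f (y : G)).1 1 := by
      simpa using coindTrivial_apply_mul (f (y : G)) x 1
    rw [← e3]
    exact e2.symm.trans e1.symm
  refine hu ?_
  have hxy' : (x : G) * y = y * x := congrArg Subtype.val hxy
  rw [key, key, hxy']; abel

variable {k G F ι : Type} [CommRing k] [IsDomain k] [Group G] [Group F]

/-- The cohomology in degree two of an extension of a free group by `ℤ²`. The hypothesis on `L` says
that `A` is the module `Hom(ker q, k)`, with `F` acting through conjugation on `ker q`. -/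
theorem nonempty_H2_equiv [IsPrincipalIdealRing k] (b : FreeGroupBasis ι F) (q : G →* F)
    (hq : Function.Surjective q)
    (s : ι → G) (hs : ∀ i, q (s i) = b i) (e : q.ker ≃* Multiplicative (Fin 2 → ℤ))
    (A : Rep.{0} k F) (L : A.V ≃ₗ[k] (Additive q.ker →+ k))
    (hL : ∀ i v (n m : q.ker), (m : G) = (s i)⁻¹ * n * s i →
      L (A.ρ (b i) v) (Additive.ofMul n) = L v (Additive.ofMul m))
    (u : cocycles₂ (Rep.trivial k G k)) (x y : q.ker)
    (hu : u ((x : G), (y : G)) ≠ u ((y : G), (x : G))) :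
    Nonempty (H2 (Rep.trivial k G k) ≃ₗ[k] (H1 A × k)) := by
  obtain ⟨d, -, h2, h3⟩ := exists_wang_sequence k k b q hq s hs 1
  obtain ⟨e₁, he₁⟩ := exists_H1_coindTrivial_equiv (k := k) (V := k) q.ker
  obtain ⟨e₂, he₂⟩ := exists_H1_coindTrivial_equiv (k := k) (V := ι → k) q.ker
  obtain ⟨e₃⟩ := nonempty_H2_equiv_of_int_sq (k := k) e k
  obtain ⟨e₄⟩ := nonempty_H1_equiv_quotient_range b A
  have hne := constMap_H2π_ne_zero u x y (e.injective (by rw [map_mul, map_mul, mul_comm])) hu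
  let e₅ := (coindIso (Rep.trivial k q.ker k) 2).toLinearEquiv.trans e₃
  obtain ⟨e₆⟩ := nonempty_equiv_quotient_range_prod (diffMap k q.ker k s 1) d
    (e₅.toLinearMap.comp (constMap k q.ker k 2)) h2
    (fun z => Iff.trans (by simp) (h3 z))
    (fun h => hne (e₅.injective ((LinearMap.congr_fun h _).trans (map_zero e₅).symm)))
  let W : H1 (coindTrivial k q.ker (ι → k)) ≃ₗ[k] (ι → A.V) :=
    (e₂.trans homPiEquiv).trans (LinearEquiv.piCongrRight fun _ => L.symm)
  have hW : ∀ z, W (diffMap k q.ker k s 1 z) = generatorDiff b A (L.symm (e₁ z)) := fun z => by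
    funext i
    change L.symm ((Pi.evalAddMonoidHom (fun _ : ι => k) i).comp
      (e₂ (diffMap k q.ker k s 1 z))) = _
    rw [LinearEquiv.symm_apply_eq, generatorDiff_apply, map_sub, LinearEquiv.apply_symm_apply]
    refine AddMonoidHom.ext fun n => ?_
    have hm := MonoidHom.normal_ker q |>.conj_mem n.toMul n.toMul.2 (s i)⁻¹
    rw [inv_inv] at hm
    refine (H1_equiv_diffMap_apply s e₁ he₁ e₂ he₂ z n.toMul ⟨_, hm⟩ i rfl).trans ?_
    have := hL i (L.symm (e₁ z)) n.toMul ⟨_, hm⟩ rfl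
    rw [LinearEquiv.apply_symm_apply] at this
    exact congrArg (fun t => e₁ z n - t) this.symm
  have hrange : (LinearMap.range (diffMap k q.ker k s 1)).map (W : _ →ₗ[k] (ι → A.V)) =
      LinearMap.range (generatorDiff b A) := by
    ext w
    constructor
    · rintro ⟨_, ⟨z, rfl⟩, rfl⟩
      exact ⟨_, (hW z).symm⟩
    · rintro ⟨v, rfl⟩
      refine ⟨_, ⟨e₁.symm (L v), rfl⟩, (hW _).trans ?_⟩
      simp
  exact ⟨e₆.trans (((Submodule.Quotient.equiv _ _ W hrange).trans e₄.symm).prodCongr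
    (LinearEquiv.refl k k))⟩

/-- In degree three, the difference operator on `H²(ker q, k) ≃ k` vanishes, as it kills a nonzero
element of `k` and has values in a torsion-free group. -/
theorem nonempty_H3_equiv (b : FreeGroupBasis ι F) (q : G →* F) (hq : Function.Surjective q)
    (e : q.ker ≃* Multiplicative (Fin 2 → ℤ))
    (u : cocycles₂ (Rep.trivial k G k)) (x y : q.ker)
    (hu : u ((x : G), (y : G)) ≠ u ((y : G), (x : G))) :
    Nonempty (groupCohomology (Rep.trivial k G k) 3 ≃ₗ[k] (ι → k)) := by
  obtain ⟨d, h1, h2, h3⟩ := exists_wang_sequence k k b q hq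
    (fun i => Function.surjInv hq (b i)) (fun i => Function.surjInv_eq hq _) 2
  set D := diffMap k q.ker k (fun i => Function.surjInv hq (b i)) 2
  obtain ⟨e₁⟩ := nonempty_H2_equiv_of_int_sq (k := k) e k
  obtain ⟨e₂⟩ := nonempty_H2_equiv_of_int_sq (k := k) e (ι → k)
  have hne := constMap_H2π_ne_zero u x y (e.injective (by rw [map_mul, map_mul, mul_comm])) hu
  let e₁' := (coindIso (Rep.trivial k q.ker k) 2).toLinearEquiv.trans e₁
  let e₂' := (coindIso (Rep.trivial k q.ker (ι → k)) 2).toLinearEquiv.trans e₂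
  have hD : ∀ z, D z = 0 := by
    intro z
    set w := constMap k q.ker k 2 (H2π _ u) with hw
    have hw0 : e₁' w ≠ 0 := fun h => hne (e₁'.injective (h.trans (map_zero e₁').symm))
    have hrel : e₁' w • z = e₁' z • w := e₁'.injective (by
      rw [map_smul, map_smul, smul_eq_mul, smul_eq_mul, mul_comm])
    have h0 : e₁' w • D z = 0 := by
      rw [← map_smul, hrel, map_smul, hw, h1.apply_apply_eq_zero, smul_zero]
    have h4 : e₁' w • e₂' (D z) = 0 := by rw [← map_smul, h0, map_zero]
    exact e₂'.injective (((smul_eq_zero.1 h4).resolve_left hw0).trans (map_zero e₂').symm)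
  have hsub := subsingleton_coindTrivial (k := k) (V := k) q.ker
    (subsingleton_cohomology_of_int_sq (k := k) e k le_rfl)
  have hbij : Function.Bijective d := by
    constructor
    · rw [← LinearMap.ker_eq_bot, LinearMap.ker_eq_bot']
      intro z hz
      obtain ⟨t, rfl⟩ := (h2 z).1 hz
      exact hD t
    · exact fun z => (h3 z).1 (hsub.elim _ _)
  exact ⟨(LinearEquiv.ofBijective d hbij).symm.trans e₂'⟩

end FreeByAbelian

/-! ### The parabolic subgroup -/

section Parabolic

theorem mem_Gamma3_iff {p : ℕ} {g : SL(3, ℤ)} :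
    g ∈ Gamma3 p ↔ ∀ i j, ((g.1 i j : ℤ) : ZMod p) = (1 : Matrix (Fin 3) (Fin 3) (ZMod p)) i j := by
  rw [Gamma3, MonoidHom.mem_ker, Matrix.SpecialLinearGroup.ext_iff]
  exact Iff.rfl

theorem dvd_of_cast_eq_zero {p : ℕ} {x : ℤ} (h : (x : ZMod p) = 0) : (p : ℤ) ∣ x :=
  (ZMod.intCast_zmod_eq_zero_iff_dvd x p).1 h

theorem parabolic_entries {p : ℕ} (hp : 3 ≤ p) {g : SL(3, ℤ)} (hg : g ∈ P1Gamma p) :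
    g.1 0 0 = 1 ∧ g.1 1 0 = 0 ∧ g.1 2 0 = 0 ∧ (p : ℤ) ∣ g.1 0 1 ∧ (p : ℤ) ∣ g.1 0 2 ∧
      g.1 1 1 * g.1 2 2 - g.1 1 2 * g.1 2 1 = 1 := by
  obtain ⟨⟨h1, h2⟩, h3⟩ := hg
  have h3 := mem_Gamma3_iff.1 h3
  have hdet : g.1 0 0 * (g.1 1 1 * g.1 2 2 - g.1 1 2 * g.1 2 1) = 1 := by
    have := g.2
    rw [Matrix.det_fin_three, h1, h2] at this
    linear_combination this
  have h00 : (p : ℤ) ∣ g.1 0 0 - 1 := dvd_of_cast_eq_zero (by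
    have := h3 0 0
    push_cast
    rw [this]; simp)
  rcases Int.mul_eq_one_iff_eq_one_or_neg_one.1 hdet with ⟨h, h'⟩ | ⟨h, h'⟩
  · exact ⟨h, h1, h2, dvd_of_cast_eq_zero (by simpa using h3 0 1),
      dvd_of_cast_eq_zero (by simpa using h3 0 2), h'⟩
  · obtain ⟨a, ha⟩ := h00
    exact (one_add_mul_ne_neg_one hp a (by linarith)).elim

/-- The block matrix with first row `(1, p v)` and lower right block `A`. -/
def blockMatrix {p : ℕ} (v : Fin 2 → ℤ) (A : Gamma p) : P1Gamma p :=
  ⟨⟨!![1, p * v 0, p * v 1; 0, A.1.1 0 0, A.1.1 0 1; 0, A.1.1 1 0, A.1.1 1 1], by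
    have := det_entries A.1
    rw [Matrix.det_fin_three]
    simp
    linarith⟩, ⟨⟨rfl, rfl⟩, mem_Gamma3_iff.2 fun i j => by
      obtain ⟨h1, h2, h3, h4⟩ := Gamma_mem.1 A.2
      fin_cases i <;> fin_cases j <;> simp [h1, h2, h3, h4]⟩⟩

theorem coe_blockMatrix {p : ℕ} (v : Fin 2 → ℤ) (A : Gamma p) : (blockMatrix v A).1.1 =
    !![1, p * v 0, p * v 1; 0, A.1.1 0 0, A.1.1 0 1; 0, A.1.1 1 0, A.1.1 1 1] := rfl

theorem blockMatrix_mul {p : ℕ} (v w : Fin 2 → ℤ) (A B : Gamma p) :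
    blockMatrix v A * blockMatrix w B = blockMatrix (w + Matrix.vecMul v B.1.1) (A * B) := by
  apply Subtype.ext
  apply Subtype.ext
  rw [Subgroup.coe_mul, Matrix.SpecialLinearGroup.coe_mul, coe_blockMatrix, coe_blockMatrix,
    coe_blockMatrix]
  ext i j
  fin_cases i <;> fin_cases j <;>
    simp [Matrix.mul_apply, Fin.sum_univ_three, Fin.sum_univ_two, Matrix.vecMul, dotProduct] <;>
    ring

theorem exists_eq_blockMatrix {p : ℕ} (hp : 3 ≤ p) (g : P1Gamma p) :
    ∃ v A, g = blockMatrix v A := by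
  obtain ⟨h00, h10, h20, ⟨x, hx⟩, ⟨y, hy⟩, hdet⟩ := parabolic_entries hp g.2
  have h3 := mem_Gamma3_iff.1 g.2.2
  refine ⟨![x, y], ⟨⟨!![g.1.1 1 1, g.1.1 1 2; g.1.1 2 1, g.1.1 2 2], ?_⟩, ?_⟩, ?_⟩
  · rw [Matrix.det_fin_two]; simpa using hdet
  · refine Gamma_mem.2 ⟨?_, ?_, ?_, ?_⟩
    · simpa using h3 1 1
    · simpa using h3 1 2
    · simpa using h3 2 1
    · simpa using h3 2 2
  · apply Subtype.ext
    apply Subtype.ext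
    rw [coe_blockMatrix]
    ext i j
    fin_cases i <;> fin_cases j <;> simp [h00, h10, h20, hx, hy]

theorem blockMatrix_injective {p : ℕ} (hp : p ≠ 0) {v w : Fin 2 → ℤ} {A B : Gamma p}
    (h : blockMatrix v A = blockMatrix w B) : v = w ∧ A = B := by
  have h' : ∀ i j, (blockMatrix v A).1.1 i j = (blockMatrix w B).1.1 i j := fun i j => by rw [h]
  simp only [coe_blockMatrix] at h'
  have hp' : (p : ℤ) ≠ 0 := by exact_mod_cast hp
  constructor
  · funext i
    fin_cases i
    · exact mul_left_cancel₀ hp' (by simpa using h' 0 1)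
    · exact mul_left_cancel₀ hp' (by simpa using h' 0 2)
  · apply Subtype.ext
    apply Subtype.ext
    ext i j
    fin_cases i <;> fin_cases j
    · simpa using h' 1 1
    · simpa using h' 1 2
    · simpa using h' 2 1
    · simpa using h' 2 2

theorem mem_P1Gamma_iff {p : ℕ} (hp : 3 ≤ p) (g : SL(3, ℤ)) : g ∈ P1Gamma p ↔
      ∃ x y : ℤ, ∃ A ∈ Gamma p, (p : ℤ) ∣ x ∧ (p : ℤ) ∣ y ∧
        g.1 = !![1, x, y; 0, A 0 0, A 0 1; 0, A 1 0, A 1 1] := by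
  constructor
  · intro hg
    obtain ⟨v, A, h⟩ := exists_eq_blockMatrix hp ⟨g, hg⟩
    exact ⟨p * v 0, p * v 1, A.1, A.2, ⟨_, rfl⟩, ⟨_, rfl⟩,
      congrArg (fun z : P1Gamma p => z.1.1) h⟩
  · rintro ⟨_, _, A, hA, ⟨x, rfl⟩, ⟨y, rfl⟩, hg⟩
    have : g = (blockMatrix ![x, y] ⟨A, hA⟩).1 := Subtype.ext (by rw [hg, coe_blockMatrix]; rfl)
    rw [this]
    exact Subtype.property _

/-- The isomorphism `ℤ² ⋊ Γ₂(p) ≃ P₁ ∩ Γ(p)`. The twist by `A` comes from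
`blockMatrix v 1 * blockMatrix 0 A = blockMatrix (v A) A`. -/
noncomputable def semidirectEquiv {p : ℕ} (hp : 3 ≤ p) :
    Multiplicative (Fin 2 → ℤ) ⋊[rowAction p] Gamma p ≃* P1Gamma p :=
  MulEquiv.ofBijective
    (MonoidHom.mk' (fun x => blockMatrix (Matrix.vecMul x.left.toAdd x.right.1.1) x.right)
      fun x y => by
        rw [blockMatrix_mul]
        have h : (rowAction p x.right y.left).toAdd =
          Matrix.vecMul y.left.toAdd ((x.right : SL(2, ℤ))⁻¹ : SL(2, ℤ)).1 := rfl
        have h2 : ((x.right : SL(2, ℤ))⁻¹ : SL(2, ℤ)).1 * (x.right.1.1 * y.right.1.1) =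
            y.right.1.1 := by
          simp only [← Matrix.SpecialLinearGroup.coe_mul, inv_mul_cancel_left]
        rw [SemidirectProduct.mul_left, SemidirectProduct.mul_right, toAdd_mul, h,
          Subgroup.coe_mul, Matrix.SpecialLinearGroup.coe_mul, Matrix.add_vecMul,
          Matrix.vecMul_vecMul, Matrix.vecMul_vecMul, h2, add_comm])
    ⟨fun x y h => by
        obtain ⟨h1, h2⟩ := blockMatrix_injective (by omega) h
        rw [h2] at h1
        have h3 : ∀ v : Fin 2 → ℤ, Matrix.vecMul (Matrix.vecMul v y.right.1.1)
            ((y.right.1)⁻¹ : SL(2, ℤ)).1 = v := fun v => by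
          rw [Matrix.vecMul_vecMul, ← Matrix.SpecialLinearGroup.coe_mul]; simp
        have h4 := congrArg (fun v => Matrix.vecMul v ((y.right.1)⁻¹ : SL(2, ℤ)).1) h1
        simp only [h3] at h4
        exact SemidirectProduct.ext h4 h2,
      fun g => by
        obtain ⟨v, A, rfl⟩ := exists_eq_blockMatrix hp g
        refine ⟨⟨Multiplicative.ofAdd (Matrix.vecMul v ((A.1)⁻¹ : SL(2, ℤ)).1), A⟩, ?_⟩
        simp only [MonoidHom.mk'_apply, toAdd_ofAdd, Matrix.vecMul_vecMul,
          ← Matrix.SpecialLinearGroup.coe_mul]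
        simp⟩

theorem semidirectEquiv_apply {p : ℕ} (hp : 3 ≤ p)
    (x : Multiplicative (Fin 2 → ℤ) ⋊[rowAction p] Gamma p) : semidirectEquiv hp x =
      blockMatrix (Matrix.vecMul x.left.toAdd x.right.1.1) x.right := rfl

/-- The lower right block, as a homomorphism to `Γ₂(p)`. -/
noncomputable def blockHom {p : ℕ} (hp : 3 ≤ p) : P1Gamma p →* Gamma p :=
  SemidirectProduct.rightHom.comp (semidirectEquiv hp).symm.toMonoidHom

theorem blockHom_blockMatrix {p : ℕ} (hp : 3 ≤ p) (v : Fin 2 → ℤ) (A : Gamma p) :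
    blockHom hp (blockMatrix v A) = A := by
  obtain ⟨x, hx⟩ := (semidirectEquiv hp).surjective (blockMatrix v A)
  have h := hx
  rw [semidirectEquiv_apply] at h
  rw [← hx, ← (blockMatrix_injective (by omega) h).2]
  simp [blockHom]

theorem blockHom_surjective {p : ℕ} (hp : 3 ≤ p) : Function.Surjective (blockHom hp) :=
  fun A => ⟨blockMatrix 0 A, blockHom_blockMatrix hp 0 A⟩

/-- The kernel of the block homomorphism consists of the `blockMatrix v 1`. -/
noncomputable def kerBlockEquiv {p : ℕ} (hp : 3 ≤ p) :
    (blockHom hp).ker ≃* Multiplicative (Fin 2 → ℤ) :=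
  (MulEquiv.ofBijective
    (MonoidHom.mk' (fun v : Multiplicative (Fin 2 → ℤ) =>
      (⟨blockMatrix v.toAdd 1, blockHom_blockMatrix hp _ _⟩ : (blockHom hp).ker)) fun v w => by
        apply Subtype.ext
        rw [Subgroup.coe_mul, blockMatrix_mul, toAdd_mul, add_comm]
        simp)
    ⟨fun v w h => (blockMatrix_injective (by omega) (congrArg Subtype.val h)).1, fun g => by
      obtain ⟨v, A, h⟩ := exists_eq_blockMatrix hp g.1
      have hg : blockHom hp g.1 = 1 := g.2
      rw [h, blockHom_blockMatrix] at hg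
      exact ⟨Multiplicative.ofAdd v, Subtype.ext (by rw [h, hg]; rfl)⟩⟩).symm

theorem coe_kerBlockEquiv_symm {p : ℕ} (hp : 3 ≤ p) (v : Fin 2 → ℤ) :
    ((kerBlockEquiv hp).symm (Multiplicative.ofAdd v)).1 = blockMatrix v 1 := rfl

theorem coe_eq_blockMatrix {p : ℕ} (hp : 3 ≤ p) (n : (blockHom hp).ker) :
    n.1 = blockMatrix (kerBlockEquiv hp n).toAdd 1 := by
  rw [← coe_kerBlockEquiv_symm hp, ofAdd_toAdd, MulEquiv.symm_apply_apply]

theorem toAdd_kerBlockEquiv_conj {p : ℕ} (hp : 3 ≤ p) (n m : (blockHom hp).ker) (A : Gamma p)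
    (h : (m : P1Gamma p) = (blockMatrix 0 A)⁻¹ * n * blockMatrix 0 A) :
    (kerBlockEquiv hp m).toAdd = Matrix.vecMul (kerBlockEquiv hp n).toAdd A.1.1 := by
  rw [mul_assoc, eq_inv_mul_iff_mul_eq, coe_eq_blockMatrix hp n, coe_eq_blockMatrix hp m,
    blockMatrix_mul, blockMatrix_mul] at h
  simpa using (blockMatrix_injective (by omega) h).1

/-- The pairing of row and column vectors identifies the natural module with the homomorphisms to `ℤ`
from the kernel of `blockHom`. -/
noncomputable def dualEquiv {p : ℕ} (hp : 3 ≤ p) :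
    (Fin 2 → ℤ) ≃ₗ[ℤ] (Additive (blockHom hp).ker →+ ℤ) where
  toFun w :=
    { toFun := fun n => dotProduct (kerBlockEquiv hp n.toMul).toAdd w
      map_zero' := by rw [toMul_zero, map_one, toAdd_one, zero_dotProduct]
      map_add' := fun n m => by rw [toMul_add, map_mul, toAdd_mul, add_dotProduct] }
  invFun f i := f (Additive.ofMul ((kerBlockEquiv hp).symm (Multiplicative.ofAdd (Pi.single i 1))))
  map_add' v w := AddMonoidHom.ext fun n =>
    dotProduct_add (kerBlockEquiv hp n.toMul).toAdd v w
  map_smul' c w := AddMonoidHom.ext fun n =>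
    dotProduct_smul c (kerBlockEquiv hp n.toMul).toAdd w
  left_inv w := by ext i; fin_cases i <;> simp
  right_inv f := by
    refine AddMonoidHom.ext fun n => ?_
    obtain ⟨n, rfl⟩ := Additive.ofMul.surjective n
    change dotProduct (kerBlockEquiv hp n).toAdd (fun i => f (Additive.ofMul
      ((kerBlockEquiv hp).symm (Multiplicative.ofAdd (Pi.single i 1))))) = f (Additive.ofMul n)
    have hn : Additive.ofMul n = (kerBlockEquiv hp n).toAdd 0 • Additive.ofMul
        ((kerBlockEquiv hp).symm (Multiplicative.ofAdd (Pi.single 0 1))) +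
        (kerBlockEquiv hp n).toAdd 1 • Additive.ofMul
        ((kerBlockEquiv hp).symm (Multiplicative.ofAdd (Pi.single 1 1))) := by
      rw [← ofMul_zpow, ← ofMul_zpow, ← ofMul_mul, ← map_zpow (kerBlockEquiv hp).symm,
        ← map_zpow (kerBlockEquiv hp).symm, ← map_mul (kerBlockEquiv hp).symm,
        ← ofAdd_zsmul, ← ofAdd_zsmul, ← ofAdd_add]
      congr 1
      rw [MulEquiv.eq_symm_apply]
      apply Multiplicative.toAdd.injective
      funext i
      fin_cases i <;> simp
    rw [hn, map_add, map_zsmul, map_zsmul]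
    simp [dotProduct, Fin.sum_univ_two]

theorem dualEquiv_apply {p : ℕ} (hp : 3 ≤ p) (w : Fin 2 → ℤ) (n : (blockHom hp).ker) :
    dualEquiv hp w (Additive.ofMul n) = dotProduct (kerBlockEquiv hp n).toAdd w := rfl

theorem dualEquiv_conj {p : ℕ} (hp : 3 ≤ p) (w : Fin 2 → ℤ) (n m : (blockHom hp).ker)
    (A : Gamma p) (h : (m : P1Gamma p) = (blockMatrix 0 A)⁻¹ * n * blockMatrix 0 A) :
    dualEquiv hp (A.1.1.mulVec w) (Additive.ofMul n) = dualEquiv hp w (Additive.ofMul m) := by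
  rw [dualEquiv_apply, dualEquiv_apply, toAdd_kerBlockEquiv_conj hp n m A h,
    Matrix.dotProduct_mulVec]

/-- The cocycle sending a pair of matrices with first rows `(1, v)`, `(1, w)` and lower right blocks
`A`, `B` to `det(v B, w)`: the invariance of the determinant under `SL₂(ℤ)`
extends the alternating form on `ℤ²` to the semidirect product. -/
def detCocycle {p : ℕ} (hp : 3 ≤ p) : cocycles₂ (Rep.trivial ℤ (P1Gamma p) ℤ) :=
  ⟨fun z => (z.1.1.1 0 1 * z.2.1.1 1 1 + z.1.1.1 0 2 * z.2.1.1 2 1) * z.2.1.1 0 2 -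
      (z.1.1.1 0 1 * z.2.1.1 1 2 + z.1.1.1 0 2 * z.2.1.1 2 2) * z.2.1.1 0 1, by
    refine (mem_cocycles₂_iff _).2 fun g h j => ?_
    obtain ⟨g00, -, -, -, -, -⟩ := parabolic_entries hp g.2
    obtain ⟨h00, h10, h20, -, -, -⟩ := parabolic_entries hp h.2
    obtain ⟨-, -, -, -, -, hj⟩ := parabolic_entries hp j.2
    simp only [Subgroup.coe_mul, Matrix.SpecialLinearGroup.coe_mul, Matrix.mul_apply,
      Fin.sum_univ_three, Representation.isTrivial_apply, g00, h00, h10, h20]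
    linear_combination (((g.1.1 0 1 * h.1.1 1 2 + g.1.1 0 2 * h.1.1 2 2) * h.1.1 0 1
      - (g.1.1 0 1 * h.1.1 1 1 + g.1.1 0 2 * h.1.1 2 1) * h.1.1 0 2)) * hj⟩

theorem detCocycle_blockMatrix {p : ℕ} (hp : 3 ≤ p) (v w : Fin 2 → ℤ) :
    detCocycle hp (blockMatrix v 1, blockMatrix w 1) =
      p * v 0 * (p * w 1) - p * v 1 * (p * w 0) := by
  change ((blockMatrix v (1 : Gamma p)).1.1 0 1 * (blockMatrix w (1 : Gamma p)).1.1 1 1 +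
    (blockMatrix v (1 : Gamma p)).1.1 0 2 * (blockMatrix w (1 : Gamma p)).1.1 2 1) *
      (blockMatrix w (1 : Gamma p)).1.1 0 2 -
    ((blockMatrix v (1 : Gamma p)).1.1 0 1 * (blockMatrix w (1 : Gamma p)).1.1 1 2 +
    (blockMatrix v (1 : Gamma p)).1.1 0 2 * (blockMatrix w (1 : Gamma p)).1.1 2 2) *
      (blockMatrix w (1 : Gamma p)).1.1 0 1 = _
  simp [coe_blockMatrix]

theorem detCocycle_not_symmetric {p : ℕ} (hp : 3 ≤ p) :
    ∃ x y : (blockHom hp).ker, detCocycle hp (x.1, y.1) ≠ detCocycle hp (y.1, x.1) := by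
  refine ⟨(kerBlockEquiv hp).symm (Multiplicative.ofAdd ![1, 0]),
    (kerBlockEquiv hp).symm (Multiplicative.ofAdd ![0, 1]), ?_⟩
  rw [coe_kerBlockEquiv_symm, coe_kerBlockEquiv_symm, detCocycle_blockMatrix,
    detCocycle_blockMatrix]
  have : (0 : ℤ) < p := by positivity
  simp
  nlinarith

/-- The elementary matrices in `Γ₂(p)` already have no common nonzero fixed vector. -/
theorem eq_zero_of_forall_mulVec_eq {p : ℕ} (hp : p ≠ 0) (w : Fin 2 → ℤ)
    (h : ∀ A : Gamma p, A.1.1.mulVec w = w) : w = 0 := by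
  have hp' : (p : ℤ) ≠ 0 := by exact_mod_cast hp
  have h1 := congr_fun (h ⟨⟨!![1, p; 0, 1], by simp⟩, Gamma_mem.2 (by simp)⟩) 0
  have h2 := congr_fun (h ⟨⟨!![1, 0; p, 1], by simp⟩, Gamma_mem.2 (by simp)⟩) 1
  simp [hp, Matrix.mulVec, dotProduct, Fin.sum_univ_two] at h1 h2
  funext i
  fin_cases i
  · exact h2
  · exact h1

/-- A homomorphism to `ℤ` restricts to a `Γ₂(p)`-invariant, hence zero, homomorphism on `ℤ²`. -/
theorem hom_eq_zero_of_mem_ker {p : ℕ} (hp : 3 ≤ p) (f : Additive (P1Gamma p) →+ ℤ)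
    (n : (blockHom hp).ker) : f (Additive.ofMul n.1) = 0 := by
  let r : Additive (blockHom hp).ker →+ ℤ :=
    f.comp (MonoidHom.toAdditive (blockHom hp).ker.subtype)
  have hr : (dualEquiv hp).symm r = 0 := by
    refine eq_zero_of_forall_mulVec_eq (p := p) (by omega) _ fun A => ?_
    apply (dualEquiv hp).injective
    refine AddMonoidHom.ext fun n => ?_
    have hm := (blockHom hp).normal_ker.conj_mem n.toMul n.toMul.2 (blockMatrix 0 A)⁻¹
    rw [inv_inv] at hm
    refine (dualEquiv_conj hp _ n.toMul ⟨_, hm⟩ A rfl).trans ?_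
    rw [LinearEquiv.apply_symm_apply]
    change f (Additive.ofMul ((blockMatrix 0 A)⁻¹ * n.toMul.1 * blockMatrix 0 A)) =
      f (Additive.ofMul n.toMul.1)
    rw [ofMul_mul, ofMul_mul, ofMul_inv, map_add, map_add, map_neg]
    abel
  have hr' : r = 0 := by rw [← (dualEquiv hp).apply_symm_apply r, hr, map_zero]
  exact DFunLike.congr_fun hr' (Additive.ofMul n)

theorem nonempty_H1_parabolic_equiv {p : ℕ} (hp : 3 ≤ p) :
    Nonempty (integralCohomology (P1Gamma p) 1 ≃ₗ[ℤ] integralCohomology (Gamma p) 1) := by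
  let sec : Gamma p →* P1Gamma p := MonoidHom.mk' (fun A => blockMatrix 0 A) fun A B => by
    rw [blockMatrix_mul]; simp
  let res : (Additive (P1Gamma p) →+ ℤ) →ₗ[ℤ] (Additive (Gamma p) →+ ℤ) :=
    { toFun := fun f => f.comp (MonoidHom.toAdditive sec)
      map_add' := fun _ _ => rfl
      map_smul' := fun _ _ => rfl }
  have hbij : Function.Bijective res := by
    constructor
    · rw [← LinearMap.ker_eq_bot, LinearMap.ker_eq_bot']
      intro f hf
      refine AddMonoidHom.ext fun g => ?_
      obtain ⟨v, A, hg⟩ := exists_eq_blockMatrix hp g.toMul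
      have hg' : g.toMul = blockMatrix 0 A * blockMatrix v 1 := by
        rw [hg, blockMatrix_mul]; simp
      have h1 : f (Additive.ofMul (blockMatrix 0 A)) = 0 :=
        DFunLike.congr_fun hf (Additive.ofMul A)
      have h2 := hom_eq_zero_of_mem_ker hp f ((kerBlockEquiv hp).symm (Multiplicative.ofAdd v))
      rw [coe_kerBlockEquiv_symm] at h2
      rw [← ofMul_toMul g, hg', ofMul_mul, map_add, h1, h2]; rfl
    · intro f
      refine ⟨f.comp (MonoidHom.toAdditive (blockHom hp)), AddMonoidHom.ext fun A => ?_⟩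
      change f (Additive.ofMul (blockHom hp (blockMatrix 0 A.toMul))) = f A
      rw [blockHom_blockMatrix]; rfl
  exact ⟨((H1IsoOfIsTrivial (Rep.trivial ℤ (P1Gamma p) ℤ)).toLinearEquiv.trans
    (LinearEquiv.ofBijective res hbij)).trans
    (H1IsoOfIsTrivial (Rep.trivial ℤ (Gamma p) ℤ)).toLinearEquiv.symm⟩

end Parabolic

end SL3Parabolic

open SL3Parabolic in
theorem proposition2p2 (p : ℕ) (hp : p.Prime) (hodd : p ≠ 2) :
    (∀ g : SL(3, ℤ), g ∈ P1Gamma p ↔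
      ∃ x y : ℤ, ∃ A ∈ Gamma p, (p : ℤ) ∣ x ∧ (p : ℤ) ∣ y ∧
        g.1 = !![1, x, y; 0, A 0 0, A 0 1; 0, A 1 0, A 1 1]) ∧
    (∃ e : Multiplicative (Fin 2 → ℤ) ⋊[rowAction p] Gamma p ≃* P1Gamma p,
      (∀ v : Fin 2 → ℤ, (e (SemidirectProduct.inl (Multiplicative.ofAdd v))).1.1 =
        !![1, p * v 0, p * v 1; 0, 1, 0; 0, 0, 1]) ∧
      (∀ A : Gamma p, (e (SemidirectProduct.inr A)).1.1 =
        !![1, 0, 0; 0, A.1 0 0, A.1 0 1; 0, A.1 1 0, A.1 1 1])) ∧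
    Nonempty (integralCohomology (P1Gamma p) 0 ≃ₗ[ℤ] ℤ) ∧
    Nonempty (integralCohomology (P1Gamma p) 1 ≃ₗ[ℤ] integralCohomology (Gamma p) 1) ∧
    Nonempty (integralCohomology (P1Gamma p) 2 ≃ₗ[ℤ]
      (groupCohomology (naturalModule p) 1 × ℤ)) ∧
    Nonempty (integralCohomology (P1Gamma p) 3 ≃ₗ[ℤ] integralCohomology (Gamma p) 1) ∧
    (∀ i : ℕ, 4 ≤ i → Subsingleton (integralCohomology (P1Gamma p) i)) := by
  have hp3 : 3 ≤ p := by have := hp.two_le; omega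
  have hfree := isFreeGroup_Gamma hp3
  let b := IsFreeGroup.basis (Gamma p)
  obtain ⟨x, y, hxy⟩ := detCocycle_not_symmetric hp3
  refine ⟨mem_P1Gamma_iff hp3, ⟨semidirectEquiv hp3, fun v => ?_, fun A => ?_⟩, ?_,
    nonempty_H1_parabolic_equiv hp3, ?_, ?_, ?_⟩
  · rw [semidirectEquiv_apply, coe_blockMatrix]
    simp
  · rw [semidirectEquiv_apply, coe_blockMatrix]
    simp
  · exact ⟨(groupCohomology.H0IsoOfIsTrivial (Rep.trivial ℤ (P1Gamma p) ℤ)).toLinearEquiv⟩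
  · obtain ⟨e⟩ := nonempty_H2_equiv b (blockHom hp3) (blockHom_surjective hp3)
      (fun i => blockMatrix 0 (b i)) (fun i => blockHom_blockMatrix hp3 _ _) (kerBlockEquiv hp3)
      (naturalModule p) (dualEquiv hp3) (fun i v n m h => dualEquiv_conj hp3 v n m (b i) h)
      (detCocycle hp3) x y hxy
    -- the two `ℤ`-module structures on the product are propositionally, not definitionally, equal
    exact ⟨{ e with
      map_smul' := fun c z => (e.map_smul c z).trans (int_smul_eq_zsmul Prod.instModule c (e z)) }⟩
  · obtain ⟨e₁⟩ := nonempty_H3_equiv b (blockHom hp3) (blockHom_surjective hp3)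
      (kerBlockEquiv hp3) (detCocycle hp3) x y hxy
    obtain ⟨e₂⟩ := nonempty_H1_trivial_equiv (k := ℤ) b ℤ
    exact ⟨e₁.trans e₂.symm⟩
  · exact fun i hi => subsingleton_cohomology_succ b (blockHom hp3) (blockHom_surjective hp3)
      (n := 3) (fun W _ _ _ hm => subsingleton_cohomology_of_int_sq (kerBlockEquiv hp3) W hm) ℤ hi
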